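/- Let $\lambda,\mu>0$, $0<a<1$, $b=1-a$, and let $A(t)=\sum_k a_k\mathbf 1_{\{t_k\le t\}}$, $t\ge 0$, be a marked Poisson process: $\{t_k\}$ is a Poisson point process of intensity $\lambda$ on $[0,\infty)$, and the marks $a_k$ are i.i.d., independent of $\{t_k\}$, and geometric on $\{1,2,\dots\}$, $P\{a_k=n\}=ab^{n-1}$. The process is observed at the times $\tau_0=0$, $\tau_n=\Delta_1+\dots+\Delta_n$, where the $\Delta_k$ are i.i.d. exponential with parameter $\mu$ and independent of $(\{t_k\},\{a_k\})$. Put $A_n=A(\tau_n)$, $\tau_{-1}=0$ and, for an integer $M\ge 0$, $$\nu=\inf\{n\ge 0: A_n>M\}.$$ Then for all integers $r\ge 0$ and all real $t\ge 0$, \begin{align*} P\{A_\nu=r,\ \tau_{\nu-1}>t\} &=\frac{\mu}{\lambda}\frac{a\mu}{\mu+\lambda}\Big[\frac{\mu+\lambda}{a\mu}R_{0r}+\sum_{j=1}^{M}R_{jr}\Big]-\frac{\mu}{\mu+\lambda}\Big[G_0R_{0r}+\sum_{j=1}^{M}(G_j-H_{j-1})R_{jr}\Big]\\ &\quad-\frac{\mu}{\lambda}\Big[\sum_{j=0}^{M}\sum_{i=0}^{M-j}c^i\mathbf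 1_{\{r=i+j\}}-(b+c)\sum_{j=0}^{M-1}\sum_{i=0}^{M-1-j}c^i\mathbf 1_{\{r=i+j+1\}}+bc\sum_{j=0}^{M-2}\sum_{i=0}^{M-2-j}c^i\mathbf 1_{\{r=i+j+2\}}\Big]\\ &\quad+\frac{\mu}{\mu+\lambda}\Big[\sum_{j=0}^{M}G_j\sum_{i=0}^{M-j}c^i\mathbf 1_{\{r=i+j\}}-\sum_{j=0}^{M-1}(bG_j+H_j)\sum_{i=0}^{M-1-j}c^i\mathbf 1_{\{r=i+j+1\}}+b\sum_{j=0}^{M-2}H_j\sum_{i=0}^{M-2-j}c^i\mathbf 1_{\{r=i+j+2\}}\Big], \end{align*} where empty sums are $0$, $$c=\frac{b\mu+\lambda}{\mu+\lambda},\qquad R_{jr}=\begin{cases}0,&r<j,\\ 1,&r=j,\\ (c-b)c^{\,r-j-1},&r>j,\end{cases}$$ $$G_j=b^j\sum_{k=0}^j\binom jk\Big(\frac ab\Big)^k\Big[P(k,\lambda t)+\frac\mu\lambda P(k+1,\lambda t)\Big],$$ $$H_j=b^{j+1}\sum_{k=0}^j\binom jk\Big(\frac ab\Big)^k\Big[P(k,\lambda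 t)+\Big(\frac\mu\lambda+\frac ab\Big)P(k+1,\lambda t)\Big],$$ and $P(k,x)=1-\Gamma(k,x)/\Gamma(k)$, with $\Gamma(k,x)=\int_x^\infty s^{k-1}e^{-s}\,ds$ for $k\ge 1$ and $P(0,x)=1$, is the lower regularized gamma function. -/

import Mathlib

open MeasureTheory ProbabilityTheory
open scoped ENNReal

namespace DelayedPassage

noncomputable section

variable {Ω : Type*}

/-! ### The marked Poisson process and its delayed observation -/

/-- The counting measure `∑ₖ ε_{tₖ}` of the random points `tₖ`, evaluated at the set `B`:
the number of indices `k` with `tₖ ∈ B`. -/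
def pointCount (time : ℕ → Ω → ℝ) (B : Set ℝ) (ω : Ω) : ℝ≥0∞ :=
  ∑' k, Measure.dirac (time k ω) B

/-- The random points `tₖ` form a (homogeneous) Poisson point process of intensity `lam` on
`[0, ∞)`: the number of points in a Borel set `B ⊆ [0, ∞)` of finite Lebesgue measure `|B|` has
the Poisson distribution with mean `lam * |B|`, and the numbers of points in pairwise disjoint
Borel sets are independent. -/
structure IsPoissonPointProcess [MeasurableSpace Ω] (P : Measure Ω) (lam : ℝ)
    (time : ℕ → Ω → ℝ) : Prop where
  measurable : ∀ k, Measurable (time k)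
  nonneg : ∀ k ω, 0 ≤ time k ω
  law_count : ∀ B : Set ℝ, MeasurableSet B → B ⊆ Set.Ici 0 → volume B ≠ ∞ →
    HasLaw (pointCount time B)
      ((poissonMeasure (lam * (volume B).toReal).toNNReal).map (Nat.cast : ℕ → ℝ≥0∞)) P
  indep_count : ∀ (n : ℕ) (B : Fin n → Set ℝ), (∀ i, MeasurableSet (B i)) →
    (∀ i, B i ⊆ Set.Ici 0) → Pairwise (fun i j => Disjoint (B i) (B j)) →
    iIndepFun (fun i => pointCount time (B i)) P

/-- `X` is geometrically distributed on `{1, 2, ...}` with parameter `a`: `P(X = n) = a bⁿ⁻¹` for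
`n ≥ 1`, where `b = 1 - a`; its generating function is `a z / (1 - b z)`. -/
def IsGeometric [MeasurableSpace Ω] (P : Measure Ω) (a : ℝ) (X : Ω → ℕ) : Prop :=
  Measurable X ∧ ∀ n : ℕ, P {ω | X ω = n + 1} = ENNReal.ofReal (a * (1 - a) ^ n)

/-- The marked point process `A(s) = ∑ₖ aₖ ε_{tₖ}[0, s]`, the sum of the marks of all points in
`[0, s]`. (With values in `[0, ∞]`, so that the series always makes sense; it is a natural number
whenever `[0, s]` contains finitely many points.) -/
def markedProcess (time : ℕ → Ω → ℝ) (mark : ℕ → Ω → ℕ) (s : ℝ) (ω : Ω) : ℝ≥0∞ :=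
  ∑' k, (mark k ω : ℝ≥0∞) * Measure.dirac (time k ω) (Set.Icc 0 s)

/-- The observation times `τ₀ = 0` and `τₙ = Δ₁ + ⋯ + Δₙ`, where `gap k` is `Δₖ₊₁`. -/
def obsTime (gap : ℕ → Ω → ℝ) (n : ℕ) (ω : Ω) : ℝ :=
  ∑ k ∈ Finset.range n, gap k ω

/-- The observed value `Aₙ = A(τₙ)`. -/
def obsValue (time : ℕ → Ω → ℝ) (mark : ℕ → Ω → ℕ) (gap : ℕ → Ω → ℝ) (n : ℕ) (ω : Ω) : ℝ≥0∞ :=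
  markedProcess time mark (obsTime gap n ω) ω

/-- The exit index `ν = inf {n = 0, 1, 2, ... : Aₙ > M}`, equal to `∞` if the set is empty. -/
def exitIndex (time : ℕ → Ω → ℝ) (mark : ℕ → Ω → ℕ) (gap : ℕ → Ω → ℝ) (M : ℕ) (ω : Ω) : ℕ∞ :=
  sInf {x : ℕ∞ | ∃ n : ℕ, x = n ∧ (M : ℝ≥0∞) < obsValue time mark gap n ω}

/-- The event `{A_ν = r, τ_{ν-1} > t}`. (As `τ₋₁ = 0 = τ₀`, the truncated difference
`0 - 1 = 0` gives the right value for `ν = 0`.) -/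
def exitEvent (time : ℕ → Ω → ℝ) (mark : ℕ → Ω → ℕ) (gap : ℕ → Ω → ℝ) (M r : ℕ) (t : ℝ) :
    Set Ω :=
  {ω | ∃ n : ℕ, exitIndex time mark gap M ω = n ∧ obsValue time mark gap n ω = r ∧
    t < obsTime gap (n - 1) ω}

/-! ### The quantities in the explicit formula -/

/-- The lower regularized gamma function `P(k, x) = 1 - Γ(k, x) / Γ(k)` for integers `k ≥ 0`, with
`Γ(k, x) = ∫_x^∞ s^(k-1) e^(-s) ds` and the usual convention `P(0, x) = 1`. -/
def regGamma (k : ℕ) (x : ℝ) : ℝ :=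
  if k = 0 then 1
  else 1 - (∫ s in Set.Ioi x, s ^ (k - 1) * Real.exp (-s)) / Real.Gamma k

/-- `G_j`, with `b = 1 - a`. -/
def coefG (a lam mu t : ℝ) (j : ℕ) : ℝ :=
  (1 - a) ^ j * ∑ k ∈ Finset.range (j + 1), (j.choose k : ℝ) * (a / (1 - a)) ^ k *
    (regGamma k (lam * t) + mu / lam * regGamma (k + 1) (lam * t))

/-- `H_j`, with `b = 1 - a`. -/
def coefH (a lam mu t : ℝ) (j : ℕ) : ℝ :=
  (1 - a) ^ (j + 1) * ∑ k ∈ Finset.range (j + 1), (j.choose k : ℝ) * (a / (1 - a)) ^ k *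
    (regGamma k (lam * t) + (mu / lam + a / (1 - a)) * regGamma (k + 1) (lam * t))

/-- `R_{jr}`, the coefficient of `v ^ r` in `v ^ j (1 - b v) / (1 - c v)`. -/
def coefR (b c : ℝ) (j r : ℕ) : ℝ :=
  if r < j then 0 else if r = j then 1 else (c - b) * c ^ (r - j - 1)

/-- The indicator `1_{r = m}`. -/
def ind (r m : ℕ) : ℝ := if r = m then 1 else 0

end

end DelayedPassage

open DelayedPassage

/-! For r ≤ M the event is empty because A_ν > M, so the right-hand side has to vanish identically;
the probability enters only for r > M.

Let r > M. Since t ≥ 0 = τ_0, the event forces ν ≥ 2. As A is nondecreasing, it is the disjoint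
union over j ≤ M and m ≥ 0 of {τ_{m+1} > t, A(τ_{m+1}) = j, A(τ_{m+2}) = r}. By independence of
increments and gaps, each piece has probability ∫_t^∞ P(A(s)=j) dP(τ_{m+1} ≤ s) · P(A(Δ)=r-j), with
Δ an independent exponential time. The Erlang densities of the τ_{m+1} add up to the constant μ
(`tsum_gammaPDF`), so summing over m gives μ ∫_t^∞ P(A(s)=j) ds · P(A(Δ)=r-j). Here A(s) is compound
Poisson with negative binomial weights: integrating the Poisson weights over (t,∞) gives
(1-P(k+1,λt))/λ, and averaging over Δ gives (μ/(μ+λ)) R_{0,r-j}. This is `measure_exitEvent`.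

The formula is matched through generating functions in v. For r > M every indicator vanishes and
Pascal's rule for G_j - H_{j-1} produces the same sum (`exitFormula_of_lt`). For r ≤ M the cutoffs
of the double sums are invisible, and the first bracket cancels the third, the second the fourth
(`exitFormula_of_le`). -/

open MeasureTheory ProbabilityTheory
open scoped ENNReal

namespace DelayedPassage

/-! ### Generating-function algebra: the formula vanishes for r ≤ M -/

/-- The convolution of a sequence with the powers of `c`. -/
noncomputable def powConv (c : ℝ) (X : ℕ → ℝ) (n : ℕ) : ℝ :=
  ∑ j ∈ Finset.range (n + 1), X j * c ^ (n - j)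

lemma powConv_zero (c : ℝ) (X : ℕ → ℝ) : powConv c X 0 = X 0 := by simp [powConv]

lemma powConv_succ (c : ℝ) (X : ℕ → ℝ) (n : ℕ) :
    powConv c X (n + 1) = c * powConv c X n + X (n + 1) := by
  unfold powConv
  rw [Finset.sum_range_succ, Finset.mul_sum]
  congr 1
  · refine Finset.sum_congr rfl fun j hj => ?_
    rw [Nat.succ_sub (Finset.mem_range_succ_iff.1 hj), pow_succ]
    ring
  · simp

lemma sum_pow_mul_ind (c : ℝ) (N m r : ℕ) :
    ∑ i ∈ Finset.range N, c ^ i * ind r (i + m) = if m ≤ r ∧ r < N + m then c ^ (r - m) else 0 := by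
  unfold ind
  split_ifs with h
  · rw [Finset.sum_eq_single_of_mem (r - m) (Finset.mem_range.2 (by omega))]
    · rw [if_pos (by omega), mul_one]
    · intro i _ hi
      rw [if_neg (by omega), mul_zero]
  · refine Finset.sum_eq_zero fun i hi => ?_
    rw [Finset.mem_range] at hi
    rw [if_neg (by omega), mul_zero]

/-- For r < N + d the cutoff i < N - j excludes no pair with i + j + d = r, so the sum is the full
coefficient of v^r in v^d X(v)/(1 - cv). -/
lemma sum_sum_pow_mul_ind_of_le (c : ℝ) (X : ℕ → ℝ) {N d r : ℕ} (h : r < N + d) :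
    ∑ j ∈ Finset.range N, X j * ∑ i ∈ Finset.range (N - j), c ^ i * ind r (i + j + d) =
      if d ≤ r then powConv c X (r - d) else 0 := by
  have h1 : ∀ j ∈ Finset.range N,
      X j * ∑ i ∈ Finset.range (N - j), c ^ i * ind r (i + j + d) =
        if j + d ≤ r then X j * c ^ (r - d - j) else 0 := by
    intro j hj
    rw [Finset.mem_range] at hj
    simp only [add_assoc]
    rw [sum_pow_mul_ind]
    by_cases hjr : j + d ≤ r
    · rw [if_pos (by omega), if_pos hjr]
      congr 2
      omega
    · rw [if_neg (by omega), if_neg hjr, mul_zero]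
  rw [Finset.sum_congr rfl h1, ← Finset.sum_filter]
  split_ifs with hd
  · unfold powConv
    refine Finset.sum_congr ?_ fun _ _ => rfl
    ext j
    simp only [Finset.mem_filter, Finset.mem_range]
    omega
  · refine Finset.sum_eq_zero fun j hj => ?_
    simp only [Finset.mem_filter, Finset.mem_range] at hj
    omega

/-- All exponents i + j + d stay below N + d. The guard 0 < N is needed for M = 0, r = 1, where the
block with N = M - 1 = 0, d = 2 is empty although N + d > r. -/
lemma sum_sum_pow_mul_ind_of_lt (c : ℝ) (X : ℕ → ℝ) {N d r : ℕ} (h : 0 < N → N + d ≤ r) :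
    ∑ j ∈ Finset.range N, X j * ∑ i ∈ Finset.range (N - j), c ^ i * ind r (i + j + d) = 0 := by
  refine Finset.sum_eq_zero fun j hj => ?_
  rw [Finset.mem_range] at hj
  simp only [add_assoc]
  rw [sum_pow_mul_ind, if_neg (by omega), mul_zero]

/-- Both sides are the coefficient of v^r in Y(v)(1 - bv)/(1 - cv); terms with j > r contribute
nothing, so stopping at M is harmless. -/
lemma sum_mul_coefR (b c : ℝ) (Y : ℕ → ℝ) {M r : ℕ} (h : r ≤ M) :
    ∑ j ∈ Finset.range (M + 1), Y j * coefR b c j r =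
      powConv c Y r - if r = 0 then 0 else b * powConv c Y (r - 1) := by
  have h1 : ∑ j ∈ Finset.range (M + 1), Y j * coefR b c j r =
      ∑ j ∈ Finset.range (r + 1), Y j * coefR b c j r := by
    symm
    refine Finset.sum_subset (Finset.range_mono (by omega)) fun j _ hj => ?_
    rw [Finset.mem_range] at hj
    rw [coefR, if_pos (by omega), mul_zero]
  rw [h1, Finset.sum_range_succ]
  cases r with
  | zero => simp [powConv, coefR]
  | succ s =>
    rw [powConv_succ]
    simp only [Nat.add_one_ne_zero, if_false, Nat.add_sub_cancel]
    have h2 : ∀ j ∈ Finset.range (s + 1), Y j * coefR b c j (s + 1) =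
        (c - b) * (Y j * c ^ (s - j)) := by
      intro j hj
      rw [Finset.mem_range] at hj
      rw [coefR, if_neg (by omega), if_neg (by omega), show s + 1 - j - 1 = s - j by omega]
      ring
    rw [Finset.sum_congr rfl h2, ← Finset.mul_sum]
    simp only [coefR, lt_irrefl, if_false, if_true]
    unfold powConv
    ring

lemma sum_range_eq_add_sum_Icc (f : ℕ → ℝ) (M : ℕ) :
    ∑ j ∈ Finset.range (M + 1), f j = f 0 + ∑ j ∈ Finset.Icc 1 M, f j := by
  rw [Finset.range_eq_Ico, Finset.sum_eq_sum_Ico_succ_bot (Nat.succ_pos M)]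
  rfl

/-- In generating functions, Y(v) = G(v) - vH(v), divided by 1 - cv. -/
lemma powConv_sub_shift (c : ℝ) (G H Y : ℕ → ℝ) (h0 : Y 0 = G 0)
    (hY : ∀ j, Y (j + 1) = G (j + 1) - H j) (n : ℕ) :
    powConv c Y (n + 1) = powConv c G (n + 1) - powConv c H n := by
  induction n with
  | zero => simp only [powConv_succ, powConv_zero, h0, hY]; ring
  | succ n ih => rw [powConv_succ, ih, hY, powConv_succ c G (n + 1), powConv_succ c H n]; ring

/-- The right-hand side of the formula for `P(A_ν = r, τ_{ν-1} > t)`. -/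
noncomputable def exitFormula (a b c lam mu : ℝ) (M r : ℕ) (G H : ℕ → ℝ) : ℝ :=
  mu / lam * (a * mu / (mu + lam)) *
        ((mu + lam) / (a * mu) * coefR b c 0 r + ∑ j ∈ Finset.Icc 1 M, coefR b c j r)
      - mu / (mu + lam) *
        (G 0 * coefR b c 0 r + ∑ j ∈ Finset.Icc 1 M, (G j - H (j - 1)) * coefR b c j r)
      - mu / lam *
        (∑ j ∈ Finset.range (M + 1), ∑ i ∈ Finset.range (M + 1 - j), c ^ i * ind r (i + j)
          - (b + c) * ∑ j ∈ Finset.range M, ∑ i ∈ Finset.range (M - j), c ^ i * ind r (i + j + 1)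
          + b * c * ∑ j ∈ Finset.range (M - 1), ∑ i ∈ Finset.range (M - 1 - j),
              c ^ i * ind r (i + j + 2))
      + mu / (mu + lam) *
        (∑ j ∈ Finset.range (M + 1), G j * ∑ i ∈ Finset.range (M + 1 - j), c ^ i * ind r (i + j)
          - ∑ j ∈ Finset.range M, (b * G j + H j) * ∑ i ∈ Finset.range (M - j),
              c ^ i * ind r (i + j + 1)
          + b * ∑ j ∈ Finset.range (M - 1), H j * ∑ i ∈ Finset.range (M - 1 - j),
              c ^ i * ind r (i + j + 2))

/-- Two identities of power series: (1 - (b+c)v + bcv²)/((1-cv)(1-v)) = (1-bv)/(1-v), which cancels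
the first bracket against the third, and G - v(bG+H) + bv²H = (1-bv)(G-vH), which cancels the second
against the fourth. -/
lemma exitFormula_of_le {a b c lam mu : ℝ} (ha0 : 0 < a) (hlam : 0 < lam)
    (hmu : 0 < mu) (hb : b = 1 - a) (hc : c = (b * mu + lam) / (mu + lam)) {M r : ℕ} (hr : r ≤ M)
    (G H : ℕ → ℝ) : exitFormula a b c lam mu M r G H = 0 := by
  have hml : mu + lam ≠ 0 := by positivity
  have hc1 : a * mu / (mu + lam) = 1 - c := by rw [hc, hb]; field_simp; ring
  have hc0 : 1 - c ≠ 0 := by rw [← hc1]; positivity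
  set K : ℕ → ℝ := fun j => if j = 0 then (mu + lam) / (a * mu) else 1 with hK
  set Y : ℕ → ℝ := fun j => if j = 0 then G 0 else G j - H (j - 1) with hY
  have eK : (mu + lam) / (a * mu) * coefR b c 0 r + ∑ j ∈ Finset.Icc 1 M, coefR b c j r =
      ∑ j ∈ Finset.range (M + 1), K j * coefR b c j r := by
    rw [sum_range_eq_add_sum_Icc]
    congr 1
    refine Finset.sum_congr rfl fun j hj => ?_
    rw [Finset.mem_Icc] at hj
    simp [hK, show j ≠ 0 by omega]
  have eY : G 0 * coefR b c 0 r + ∑ j ∈ Finset.Icc 1 M, (G j - H (j - 1)) * coefR b c j r =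
      ∑ j ∈ Finset.range (M + 1), Y j * coefR b c j r := by
    rw [sum_range_eq_add_sum_Icc]
    congr 1
    refine Finset.sum_congr rfl fun j hj => ?_
    rw [Finset.mem_Icc] at hj
    simp [hY, show j ≠ 0 by omega]
  have e0 := fun X => sum_sum_pow_mul_ind_of_le c X (N := M + 1) (d := 0) (r := r) (by omega)
  have e1 := fun X => sum_sum_pow_mul_ind_of_le c X (N := M) (d := 1) (r := r) (by omega)
  have e2 := fun X => sum_sum_pow_mul_ind_of_le c X (N := M - 1) (d := 2) (r := r) (by omega)
  have f0 := e0 1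
  have f1 := e1 1
  have f2 := e2 1
  simp only [Pi.one_apply, one_mul, add_zero] at e0 f0 f1 f2
  -- K(v) = 1/(1-c) + v/(1-v) = (1-cv)/((1-c)(1-v)), so division by 1-cv leaves a constant sequence.
  have hKc : ∀ n, (1 - c) * powConv c K n = 1 := by
    intro n
    induction n with
    | zero => rw [powConv_zero, ← hc1]; simp only [hK, if_true]; field_simp
    | succ n ih =>
      rw [powConv_succ]
      have : K (n + 1) = 1 := by simp [hK]
      rw [this]
      linear_combination c * ih
  have hsplit : ∀ n, powConv c (fun j => b * G j + H j) n = b * powConv c G n + powConv c H n := by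
    intro n
    simp only [powConv, Finset.mul_sum, ← Finset.sum_add_distrib]
    exact Finset.sum_congr rfl fun j _ => by ring
  have hYs := powConv_sub_shift c G H Y (by simp [hY]) (by simp [hY])
  have hY0 : Y 0 = G 0 := by simp [hY]
  unfold exitFormula
  rw [eK, eY, sum_mul_coefR b c K hr, sum_mul_coefR b c Y hr, e0 G, e1 (fun j => b * G j + H j),
    e2 H, f0, f1, f2, hc1]
  -- The cases r = 0, r = 1, r ≥ 2 decide which of the shifts by 1 and 2 are present.
  rcases r with _ | _ | s
  · simp only [powConv_zero, hY0]
    have := hKc 0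
    rw [powConv_zero] at this
    simp [powConv_zero]
    linear_combination mu / lam * this
  · have h0 := hKc 0
    have h1 := hKc 1
    simp [hYs, hsplit]
    rw [powConv_succ c 1 0]
    simp only [powConv_zero, Pi.one_apply, hY0] at h0 ⊢
    linear_combination mu / lam * h1 - mu / lam * b * h0
  · have h0 := hKc (s + 1)
    have h1 := hKc (s + 2)
    simp [hYs, hsplit]
    rw [powConv_succ c 1 (s + 1), powConv_succ c 1 s]
    simp only [Pi.one_apply]
    linear_combination mu / lam * h1 - mu / lam * b * h0

/-! ### Negative binomial weights and the formula for r > M -/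

/-- The probability that `k` independent geometric variables on `{1, 2, …}` add up to `j`. -/
noncomputable def negBinomialMass (a : ℝ) : ℕ → ℕ → ℝ
  | 0, 0 => 1
  | 0, _ + 1 => 0
  | _ + 1, 0 => 0
  | k + 1, j + 1 => j.choose k * a ^ (k + 1) * (1 - a) ^ (j - k)

lemma negBinomialMass_nonneg {a : ℝ} (ha0 : 0 ≤ a) (ha1 : a ≤ 1) (k j : ℕ) :
    0 ≤ negBinomialMass a k j := by
  have : 0 ≤ 1 - a := by linarith
  rcases k with _ | k <;> rcases j with _ | j <;> simp only [negBinomialMass] <;> positivity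

lemma negBinomialMass_of_lt (a : ℝ) {k j : ℕ} (h : j < k) : negBinomialMass a k j = 0 := by
  rcases k with _ | k <;> rcases j with _ | j <;> simp only [negBinomialMass]
  · omega
  · rw [Nat.choose_eq_zero_of_lt (by omega)]; simp

lemma negBinomialMass_succ_succ (a : ℝ) (k j : ℕ) :
    negBinomialMass a (k + 1) (j + 1) =
      a * negBinomialMass a k j + (1 - a) * negBinomialMass a (k + 1) j := by
  rcases k with _ | k <;> rcases j with _ | j <;> simp only [negBinomialMass]
  · simp
  · simp [pow_succ]; ring
  · simp
  · rw [Nat.choose_succ_succ]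
    rcases lt_trichotomy j k with h | h | h
    · simp [Nat.choose_eq_zero_of_lt h, Nat.choose_eq_zero_of_lt (Nat.lt_succ_of_lt h)]
    · subst h; simp; ring
    · rw [show j + 1 - (k + 1) = j - k by omega, show j - k = (j - (k + 1)) + 1 by omega]
      push_cast
      ring

/-- The increment `G_j - H_{j-1}`. -/
lemma coefG_sub_coefH {a lam mu t : ℝ} (ha1 : a < 1) (j : ℕ) :
    coefG a lam mu t (j + 1) - coefH a lam mu t j = mu / lam *
      ∑ k ∈ Finset.range (j + 2), negBinomialMass a k (j + 1) * regGamma (k + 1) (lam * t) := by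
  have hb : (1 - a) ≠ 0 := by linarith
  set p : ℕ → ℝ := fun k => regGamma k (lam * t) with hp
  have h1 : coefG a lam mu t (j + 1) = ∑ k ∈ Finset.range (j + 2), ((j + 1).choose k : ℝ) *
      (a ^ k * (1 - a) ^ (j + 1 - k)) * (p k + mu / lam * p (k + 1)) := by
    rw [coefG, Finset.mul_sum]
    refine Finset.sum_congr rfl fun k hk => ?_
    rw [Finset.mem_range] at hk
    rw [div_pow, pow_sub₀ _ hb (by omega)]
    ring
  have h2 : coefH a lam mu t j = ∑ k ∈ Finset.range (j + 1), (j.choose k : ℝ) *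
      (a ^ k * (1 - a) ^ (j - k)) * ((1 - a) * p k + ((1 - a) * (mu / lam) + a) * p (k + 1)) := by
    rw [coefH, Finset.mul_sum]
    refine Finset.sum_congr rfl fun k hk => ?_
    rw [Finset.mem_range] at hk
    rw [div_pow, pow_sub₀ _ hb (by omega), pow_succ]
    simp only [hp]
    field_simp
  have h3 : ∑ k ∈ Finset.range (j + 2), negBinomialMass a k (j + 1) * p (k + 1) =
      ∑ k ∈ Finset.range (j + 1),
        (j.choose k : ℝ) * a ^ (k + 1) * (1 - a) ^ (j - k) * p (k + 2) := by
    rw [Finset.sum_range_succ']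
    simp [negBinomialMass]
  have h4 : ∑ k ∈ Finset.range (j + 2), (j.choose k : ℝ) *
      (a ^ k * (1 - a) ^ (j + 1 - k)) * (p k + mu / lam * p (k + 1)) =
      ∑ k ∈ Finset.range (j + 1), (j.choose k : ℝ) *
      (a ^ k * (1 - a) ^ (j - k)) * ((1 - a) * (p k + mu / lam * p (k + 1))) := by
    rw [Finset.sum_range_succ, Nat.choose_eq_zero_of_lt (Nat.lt_succ_self j)]
    simp only [Nat.cast_zero, zero_mul, add_zero]
    refine Finset.sum_congr rfl fun k hk => ?_
    rw [Finset.mem_range] at hk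
    rw [show j + 1 - k = j - k + 1 by omega]
    ring
  -- Pascal's rule for the binomials of index j + 1. Subtracting H_j then cancels all terms in p k
  -- and p (k + 1), leaving only a (μ/λ) p (k + 2).
  have h5 : coefG a lam mu t (j + 1) =
      ∑ k ∈ Finset.range (j + 1), (j.choose k : ℝ) *
        (a ^ k * (1 - a) ^ (j - k)) * ((1 - a) * (p k + mu / lam * p (k + 1))) +
      ∑ k ∈ Finset.range (j + 1), (j.choose k : ℝ) *
        (a ^ (k + 1) * (1 - a) ^ (j - k)) * (p (k + 1) + mu / lam * p (k + 2)) := by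
    rw [h1, ← h4, Finset.sum_range_succ' _ (j + 1), Finset.sum_range_succ' _ (j + 1),
      add_right_comm,
      ← Finset.sum_add_distrib]
    congr 1
    · refine Finset.sum_congr rfl fun k _ => ?_
      rw [Nat.choose_succ_succ, show j + 1 - (k + 1) = j - k by omega]
      push_cast
      ring
    · simp
  rw [h3, h5, h2, Finset.mul_sum, ← Finset.sum_add_distrib, ← Finset.sum_sub_distrib]
  refine Finset.sum_congr rfl fun k _ => ?_
  ring

/-- The binomial theorem; probabilistically, a walk with geometric steps visits each j ≥ 1 with
probability a, and visits 0 surely. -/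
lemma sum_negBinomialMass (a : ℝ) (j : ℕ) :
    ∑ k ∈ Finset.range (j + 1), negBinomialMass a k j = if j = 0 then 1 else a := by
  rcases j with _ | j
  · simp [negBinomialMass]
  · rw [Finset.sum_range_succ']
    simp only [negBinomialMass, add_zero, Nat.add_one_ne_zero, if_false]
    have := add_pow a (1 - a) j
    rw [add_sub_cancel, one_pow] at this
    calc _ = a * ∑ m ∈ Finset.range (j + 1), a ^ m * (1 - a) ^ (j - m) * (j.choose m : ℝ) := by
          rw [Finset.mul_sum]
          exact Finset.sum_congr rfl fun k _ => by ring
      _ = a := by rw [← this, mul_one]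

lemma coefR_eq_coefR_zero (b c : ℝ) {j r : ℕ} (h : j ≤ r) :
    coefR b c j r = coefR b c 0 (r - j) := by
  simp only [coefR, not_lt.2 h, Nat.not_lt_zero, if_false, Nat.sub_zero]
  congr 1
  simp only [eq_iff_iff]
  omega

/-- The double sums vanish, and R_{jr} = R_{0,r-j}. The remaining coefficients of R_{jr} become
Poisson tails because the negative binomial masses sum to a for j ≥ 1. For j = 0 they sum to 1,
which explains the separate constant (μ+λ)/(aμ). -/
lemma exitFormula_of_lt {a b c lam mu t : ℝ} (ha0 : 0 < a) (ha1 : a < 1) (hlam : 0 < lam)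
    (hmu : 0 < mu) {M r : ℕ} (hr : M < r) :
    exitFormula a b c lam mu M r (coefG a lam mu t) (coefH a lam mu t) =
      ∑ j ∈ Finset.range (M + 1), mu / lam *
        (∑ k ∈ Finset.range (j + 1), negBinomialMass a k j * (1 - regGamma (k + 1) (lam * t))) *
        (mu / (mu + lam) * coefR b c 0 (r - j)) := by
  have e0 := fun X => sum_sum_pow_mul_ind_of_lt c X (N := M + 1) (d := 0) (r := r) (by omega)
  have e1 := fun X => sum_sum_pow_mul_ind_of_lt c X (N := M) (d := 1) (r := r) (by omega)
  have e2 := fun X => sum_sum_pow_mul_ind_of_lt c X (N := M - 1) (d := 2) (r := r) (by omega)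
  have f0 := e0 1
  have f1 := e1 1
  have f2 := e2 1
  simp only [Pi.one_apply, one_mul, add_zero] at e0 f0 f1 f2
  unfold exitFormula
  rw [e0, e1 (fun j => b * coefG a lam mu t j + coefH a lam mu t j), e2, f0, f1, f2]
  rw [sum_range_eq_add_sum_Icc, mul_add, mul_add, Finset.mul_sum, Finset.mul_sum]
  have hG0 : coefG a lam mu t 0 = 1 + mu / lam * regGamma 1 (lam * t) := by
    simp [coefG, regGamma]
  have key : ∀ j ∈ Finset.Icc 1 M, mu / lam *
        (∑ k ∈ Finset.range (j + 1), negBinomialMass a k j * (1 - regGamma (k + 1) (lam * t))) *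
        (mu / (mu + lam) * coefR b c 0 (r - j)) =
      mu / lam * (a * mu / (mu + lam)) * coefR b c j r -
      mu / (mu + lam) * ((coefG a lam mu t j - coefH a lam mu t (j - 1)) * coefR b c j r) := by
    intro j hj
    rw [Finset.mem_Icc] at hj
    obtain ⟨i, rfl⟩ : ∃ i, j = i + 1 := ⟨j - 1, by omega⟩
    rw [Nat.add_sub_cancel, coefG_sub_coefH ha1, coefR_eq_coefR_zero b c (by omega : i + 1 ≤ r)]
    simp only [mul_sub, mul_one, Finset.sum_sub_distrib]
    rw [sum_negBinomialMass, if_neg (by omega)]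
    ring
  rw [Finset.sum_congr rfl key, Finset.sum_sub_distrib, hG0]
  simp only [zero_add, Finset.sum_range_one, negBinomialMass, Nat.sub_zero]
  field_simp
  ring

/-! ### Sums of geometric marks -/

section Marks

variable {Ω : Type*} [MeasurableSpace Ω] {P : Measure Ω} {a : ℝ}

lemma tsum_measure_nat_fiber [IsProbabilityMeasure P] {X : Ω → ℕ} (hX : Measurable X) :
    ∑' n, P {ω | X ω = n} = 1 := by
  rw [← measure_univ (μ := P), ← measure_iUnion]
  · congr 1
    ext ω
    simp
  · intro i j hij
    rw [Function.onFun, Set.disjoint_left]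
    intro ω h1 h2
    exact hij (h1.symm.trans h2)
  · intro n
    exact hX (measurableSet_singleton n)

/-- `IsGeometric` prescribes only the masses at positive integers; these already add up to 1. -/
lemma IsGeometric.measure_zero [IsProbabilityMeasure P] (ha0 : 0 < a) (ha1 : a < 1) {X : Ω → ℕ}
    (hX : IsGeometric P a X) : P {ω | X ω = 0} = 0 := by
  have h := tsum_measure_nat_fiber (P := P) hX.1
  rw [tsum_eq_zero_add' ENNReal.summable] at h
  simp only [hX.2] at h
  have hs : HasSum (fun n : ℕ => a * (1 - a) ^ n) 1 := by
    have := (hasSum_geometric_of_lt_one (by linarith : 0 ≤ 1 - a) (by linarith)).mul_left a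
    rwa [sub_sub_cancel, mul_inv_cancel₀ ha0.ne'] at this
  have hb : 0 ≤ 1 - a := by linarith
  rw [← ENNReal.ofReal_tsum_of_nonneg (fun n => by positivity) hs.summable, hs.tsum_eq,
    ENNReal.ofReal_one] at h
  exact (ENNReal.add_left_inj ENNReal.one_ne_top).1 (h.trans (zero_add 1).symm)

lemma measure_add_eq_sum_of_indepFun {X Y : Ω → ℕ} (hX : Measurable X) (hY : Measurable Y)
    (h : IndepFun X Y P) (n : ℕ) :
    P {ω | X ω + Y ω = n} =
      ∑ i ∈ Finset.range (n + 1), P {ω | X ω = i} * P {ω | Y ω = n - i} := by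
  have h1 : {ω | X ω + Y ω = n} =
      ⋃ i ∈ Finset.range (n + 1), (X ⁻¹' {i} ∩ Y ⁻¹' {n - i}) := by
    ext ω
    simp only [Set.mem_ofPred_eq, Set.mem_iUnion, Finset.mem_range, Set.mem_inter_iff,
      Set.mem_preimage, Set.mem_singleton_iff, exists_prop]
    constructor
    · intro h
      exact ⟨X ω, by omega, rfl, by omega⟩
    · rintro ⟨i, hi, h1, h2⟩
      omega
  rw [h1, measure_biUnion_finset]
  · refine Finset.sum_congr rfl fun i _ => ?_
    exact h.measure_inter_preimage_eq_mul _ _ (measurableSet_singleton _)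
      (measurableSet_singleton _)
  · intro i _ j _ hij
    rw [Function.onFun, Set.disjoint_left]
    intro ω h1 h2
    exact hij (h1.1.symm.trans h2.1)
  · intro i _
    exact (hX (measurableSet_singleton _)).inter (hY (measurableSet_singleton _))

lemma sum_negBinomialMass_mul_geometric (a : ℝ) (k j : ℕ) :
    ∑ i ∈ Finset.range (j + 1), negBinomialMass a k i * (a * (1 - a) ^ (j - i)) =
      negBinomialMass a (k + 1) (j + 1) := by
  induction j with
  | zero => simp [negBinomialMass_succ_succ]; rw [negBinomialMass]; ring
  | succ j ih =>
    rw [negBinomialMass_succ_succ, ← ih, Finset.sum_range_succ, Finset.mul_sum, add_comm]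
    congr 1
    · simp; ring
    · refine Finset.sum_congr rfl fun i hi => ?_
      rw [Finset.mem_range] at hi
      rw [show j + 1 - i = j - i + 1 by omega]
      ring

lemma measure_sum_geometric [IsProbabilityMeasure P] (ha0 : 0 < a) (ha1 : a < 1)
    {mark : ℕ → Ω → ℕ} (hmark : ∀ k, IsGeometric P a (mark k)) (hindep : iIndepFun mark P)
    (F : Finset ℕ) (j : ℕ) :
    P {ω | ∑ k ∈ F, mark k ω = j} = ENNReal.ofReal (negBinomialMass a F.card j) := by
  have hb : 0 ≤ 1 - a := by linarith
  induction F using Finset.induction_on generalizing j with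
  | empty => rcases j with _ | j <;> simp [negBinomialMass]
  | insert i F hi ih =>
    have h1 : ∀ ω, ∑ k ∈ insert i F, mark k ω = (∑ k ∈ F, mark k) ω + mark i ω := by
      intro ω
      rw [Finset.sum_insert hi, add_comm, Finset.sum_apply]
    have hm : Measurable (∑ k ∈ F, mark k) := by
      convert! Finset.measurable_sum F fun k _ => (hmark k).1 using 1
      ext ω
      simp
    simp only [h1]
    rw [measure_add_eq_sum_of_indepFun
      hm (hmark i).1
      (hindep.indepFun_finsetSum_of_notMem (fun k => (hmark k).1) hi)]
    simp only [Finset.sum_apply, ih]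
    -- The last term of the convolution would need a zero mark, which is null.
    rw [Finset.card_insert_of_notMem hi, Finset.sum_range_succ, Nat.sub_self,
      (hmark i).measure_zero ha0 ha1, mul_zero, add_zero]
    rcases j with _ | j
    · simp [negBinomialMass]
    · rw [← sum_negBinomialMass_mul_geometric, ENNReal.ofReal_sum_of_nonneg]
      · refine Finset.sum_congr rfl fun l hl => ?_
        rw [Finset.mem_range] at hl
        rw [show j + 1 - l = j - l + 1 by omega, (hmark i).2,
          ENNReal.ofReal_mul (negBinomialMass_nonneg ha0.le ha1.le _ _)]
      · intro l _
        have := negBinomialMass_nonneg ha0.le ha1.le F.card l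
        positivity

lemma measure_sum_geometric_inter [IsProbabilityMeasure P] (ha0 : 0 < a) (ha1 : a < 1)
    {mark : ℕ → Ω → ℕ} (hmark : ∀ k, IsGeometric P a (mark k)) (hindep : iIndepFun mark P)
    {F₁ F₂ : Finset ℕ} (hF : Disjoint F₁ F₂) (j n : ℕ) :
    P {ω | ∑ k ∈ F₁, mark k ω = j ∧ ∑ k ∈ F₂, mark k ω = n} =
      ENNReal.ofReal (negBinomialMass a F₁.card j) *
        ENNReal.ofReal (negBinomialMass a F₂.card n) := by
  rw [← measure_sum_geometric ha0 ha1 hmark hindep, ← measure_sum_geometric ha0 ha1 hmark hindep]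
  have h := (hindep.indepFun_finset F₁ F₂ hF fun k => (hmark k).1).comp
    (φ := fun v : F₁ → ℕ => ∑ i, v i) (ψ := fun v : F₂ → ℕ => ∑ i, v i) (by fun_prop) (by fun_prop)
  have h2 := h.measure_inter_preimage_eq_mul {j} {n} (measurableSet_singleton _)
    (measurableSet_singleton _)
  have e : ∀ (F : Finset ℕ) (m : ℕ),
      ((fun v : F → ℕ => ∑ i, v i) ∘ fun ω (i : F) => mark i ω) ⁻¹' {m} = {ω | ∑ k ∈ F, mark k ω = m} := by
    intro F m
    ext ω
    simp only [Set.mem_preimage, Function.comp, Set.mem_singleton_iff, Set.mem_ofPred_eq]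
    rw [Finset.sum_coe_sort F (fun i => mark i ω)]
  rw [e, e] at h2
  exact h2

end Marks

/-! ### Pathwise decomposition of the exit event -/

section Paths

variable {Ω : Type*} {time : ℕ → Ω → ℝ} {mark : ℕ → Ω → ℕ} {gap : ℕ → Ω → ℝ}

/-- The sum of the marks of the points in `B`. -/
noncomputable def markSum (time : ℕ → Ω → ℝ) (mark : ℕ → Ω → ℕ) (B : Set ℝ) (ω : Ω) : ℝ≥0∞ :=
  ∑' k, (mark k ω : ℝ≥0∞) * Measure.dirac (time k ω) B

lemma tsum_mul_dirac_eq_sum {x : ℕ → ℝ} (m : ℕ → ℝ≥0∞) {B : Set ℝ} (hB : MeasurableSet B)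
    {F : Finset ℕ} (hF : ∀ k, x k ∈ B ↔ k ∈ F) :
    ∑' k, m k * Measure.dirac (x k) B = ∑ k ∈ F, m k := by
  rw [tsum_eq_sum (s := F)]
  · refine Finset.sum_congr rfl fun k hk => ?_
    rw [Measure.dirac_apply' _ hB, Set.indicator_of_mem ((hF k).2 hk), Pi.one_apply, mul_one]
  · intro k hk
    rw [Measure.dirac_apply' _ hB, Set.indicator_of_notMem (fun h => hk ((hF k).1 h)), mul_zero]

lemma pointCount_eq_card {B : Set ℝ} (hB : MeasurableSet B) {F : Finset ℕ} {ω : Ω}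
    (hF : ∀ k, time k ω ∈ B ↔ k ∈ F) : pointCount time B ω = F.card := by
  have := tsum_mul_dirac_eq_sum (fun _ => 1) hB hF
  simpa [pointCount] using this

lemma markSum_eq_sum {B : Set ℝ} (hB : MeasurableSet B) {F : Finset ℕ} {ω : Ω}
    (hF : ∀ k, time k ω ∈ B ↔ k ∈ F) :
    markSum time mark B ω = ((∑ k ∈ F, mark k ω : ℕ) : ℝ≥0∞) := by
  rw [markSum, tsum_mul_dirac_eq_sum _ hB hF, Nat.cast_sum]

lemma exists_finset_of_pointCount_ne_top {B : Set ℝ} (hB : MeasurableSet B) {ω : Ω}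
    (h : pointCount time B ω ≠ ∞) : ∃ F : Finset ℕ, ∀ k, time k ω ∈ B ↔ k ∈ F := by
  have hfin := ENNReal.finite_const_le_of_tsum_ne_top h one_ne_zero
  refine ⟨hfin.toFinset, fun k => ?_⟩
  rw [Set.Finite.mem_toFinset, Set.mem_ofPred_eq, Measure.dirac_apply' _ hB]
  by_cases hk : time k ω ∈ B <;> simp [hk]

lemma markedProcess_add {x z : ℝ} (hx : 0 ≤ x) (hz : 0 ≤ z) (ω : Ω) :
    markedProcess time mark (x + z) ω =
      markSum time mark (Set.Icc 0 x) ω + markSum time mark (Set.Ioc x (x + z)) ω := by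
  rw [markedProcess, markSum, markSum, ← ENNReal.tsum_add]
  refine tsum_congr fun k => ?_
  rw [← mul_add, ← Set.Icc_union_Ioc_eq_Icc hx (le_add_of_nonneg_right hz), measure_union]
  · rw [Set.disjoint_left]
    intro s h h'
    exact not_lt.2 h.2 h'.1
  · exact measurableSet_Ioc

lemma markedProcess_mono {x y : ℝ} (hxy : x ≤ y) (ω : Ω) :
    markedProcess time mark x ω ≤ markedProcess time mark y ω := by
  refine ENNReal.tsum_le_tsum fun k => ?_
  gcongr

/-- A mark sum which is at most `M` is a natural number which is at most `M`. -/
lemma markSum_le_natCast_iff {B : Set ℝ} (hB : MeasurableSet B) {M : ℕ} {ω : Ω} :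
    markSum time mark B ω ≤ M ↔ ∃ j ∈ Finset.range (M + 1), markSum time mark B ω = j := by
  constructor
  · intro h
    -- Marks may be 0 on a null set, so B may hold infinitely many points even if the sum is finite.
    -- Only the indices contributing at least 1 are collected; the other contributions, being
    -- natural numbers, are 0.
    have hfin := ENNReal.finite_const_le_of_tsum_ne_top
      (ne_top_of_le_ne_top (ENNReal.natCast_ne_top M) h) one_ne_zero
    have e : markSum time mark B ω =
        ((∑ k ∈ hfin.toFinset, mark k ω : ℕ) : ℝ≥0∞) := by
      rw [markSum, tsum_eq_sum (s := hfin.toFinset), Nat.cast_sum]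
      · refine Finset.sum_congr rfl fun k hk => ?_
        rw [Set.Finite.mem_toFinset, Set.mem_ofPred_eq, Measure.dirac_apply' _ hB] at hk
        rw [Measure.dirac_apply' _ hB]
        by_cases hk' : time k ω ∈ B <;> simp_all
      · intro k hk
        rw [Set.Finite.mem_toFinset, Set.mem_ofPred_eq, Measure.dirac_apply' _ hB, not_le] at hk
        rw [Measure.dirac_apply' _ hB]
        by_cases hk' : time k ω ∈ B
        · simp only [hk', Set.indicator_of_mem, Pi.one_apply, mul_one] at hk ⊢
          exact_mod_cast Nat.lt_one_iff.1 (by exact_mod_cast hk)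
        · simp [hk']
    rw [e] at h ⊢
    exact ⟨_, Finset.mem_range_succ_iff.2 (by exact_mod_cast h), rfl⟩
  · rintro ⟨j, hj, h⟩
    rw [h]
    exact_mod_cast Finset.mem_range_succ_iff.1 hj

lemma obsTime_mono (hgap : ∀ k ω, 0 ≤ gap k ω) (ω : Ω) : Monotone fun n => obsTime gap n ω :=
  monotone_nat_of_le_succ fun n => by
    simp only [obsTime]
    rw [Finset.sum_range_succ]
    exact le_add_of_nonneg_right (hgap n ω)

lemma obsTime_nonneg (hgap : ∀ k ω, 0 ≤ gap k ω) (n : ℕ) (ω : Ω) : 0 ≤ obsTime gap n ω :=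
  Finset.sum_nonneg fun k _ => hgap k ω

lemma obsValue_mono (hgap : ∀ k ω, 0 ≤ gap k ω) (ω : Ω) :
    Monotone fun n => obsValue time mark gap n ω :=
  fun _ _ h => markedProcess_mono (obsTime_mono hgap ω h) ω

lemma lt_obsValue_of_exitIndex_eq {M n : ℕ} {ω : Ω}
    (h : exitIndex time mark gap M ω = n) : (M : ℝ≥0∞) < obsValue time mark gap n ω := by
  have hne : {x : ℕ∞ | ∃ n : ℕ, x = n ∧ (M : ℝ≥0∞) < obsValue time mark gap n ω}.Nonempty := by
    by_contra hne
    rw [Set.not_nonempty_iff_eq_empty] at hne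
    rw [exitIndex, hne, sInf_empty] at h
    exact ENat.natCast_ne_top n h.symm
  obtain ⟨m, hm, hm'⟩ := csInf_mem hne
  have : m = n := by exact_mod_cast hm.symm.trans h
  rwa [← this]

lemma exitEvent_eq_empty {M r : ℕ} (hr : r ≤ M) (t : ℝ) : exitEvent time mark gap M r t = ∅ := by
  rw [Set.eq_empty_iff_forall_notMem]
  rintro ω ⟨n, h1, h2, -⟩
  have h3 := lt_obsValue_of_exitIndex_eq h1
  rw [h2] at h3
  exact absurd (by exact_mod_cast h3 : M < r) (not_lt.2 hr)

/-- The exit at `τ_{m+2}` to the level `r` from the level `j`. -/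
def passageFrom (time : ℕ → Ω → ℝ) (mark : ℕ → Ω → ℕ) (gap : ℕ → Ω → ℝ) (t : ℝ) (r j m : ℕ) :
    Set Ω :=
  {ω | t < obsTime gap (m + 1) ω ∧ obsValue time mark gap (m + 1) ω = j ∧
    obsValue time mark gap (m + 2) ω = r}

/-- For ν = 0 or 1 the last time before exit is 0, contradicting t ≥ 0. For ν = m + 2, minimality
bounds A_{m+1} by M; conversely, monotonicity excludes an earlier exit. -/
lemma exitEvent_eq_iUnion (hgap : ∀ k ω, 0 ≤ gap k ω) {M r : ℕ} (hr : M < r) {t : ℝ} (ht : 0 ≤ t) :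
    exitEvent time mark gap M r t =
      ⋃ j ∈ Finset.range (M + 1), ⋃ m, passageFrom time mark gap t r j m := by
  ext ω
  simp only [Set.mem_iUnion, exists_prop]
  constructor
  · rintro ⟨n, h1, h2, h3⟩
    rcases n with _ | _ | m
    · simp [obsTime] at h3
      linarith
    · simp [obsTime] at h3
      linarith
    · have h4 : obsValue time mark gap (m + 1) ω ≤ M := by
        by_contra h4
        have h5 : exitIndex time mark gap M ω ≤ (m + 1 : ℕ) := sInf_le ⟨m + 1, rfl, not_le.1 h4⟩
        rw [h1] at h5
        have : m + 2 ≤ m + 1 := by exact_mod_cast h5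
        omega
      obtain ⟨j, hj, h5⟩ := (markSum_le_natCast_iff measurableSet_Icc).1 h4
      exact ⟨j, hj, m, h3, h5, h2⟩
  · rintro ⟨j, hj, m, h1, h2, h3⟩
    rw [Finset.mem_range_succ_iff] at hj
    refine ⟨m + 2, le_antisymm (sInf_le ⟨m + 2, rfl, ?_⟩) (le_sInf ?_), h3, h1⟩
    · rw [h3]
      exact_mod_cast hr
    · rintro _ ⟨n, rfl, hn⟩
      by_contra hlt
      have hlt' : n < m + 2 := by exact_mod_cast not_le.1 hlt
      have h4 := obsValue_mono (time := time) (mark := mark) hgap ω (by omega : n ≤ m + 1)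
      simp only [h2] at h4
      have h5 : M < j := by exact_mod_cast hn.trans_le h4
      omega

/-- If m < m', a common point would give r = A_{m+2} ≤ A_{m'+1} = j' ≤ M < r. -/
lemma passageFrom_disjoint (hgap : ∀ k ω, 0 ≤ gap k ω) {M r j j' m m' : ℕ} (hr : M < r)
    (hj : j ≤ M) (hj' : j' ≤ M) {t : ℝ} (hne : j ≠ j' ∨ m ≠ m') :
    Disjoint (passageFrom time mark gap t r j m) (passageFrom time mark gap t r j' m') := by
  rw [Set.disjoint_left]
  rintro ω ⟨-, h2, h3⟩ ⟨-, h2', h3'⟩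
  have hmono := obsValue_mono (time := time) (mark := mark) hgap ω
  rcases lt_trichotomy m m' with h | h | h
  · have h4 := hmono (by omega : m + 2 ≤ m' + 1)
    simp only [h3, h2'] at h4
    have : r ≤ j' := by exact_mod_cast h4
    omega
  · subst h
    rw [h2] at h2'
    have : j = j' := by exact_mod_cast h2'
    omega
  · have h4 := hmono (by omega : m' + 2 ≤ m + 1)
    simp only [h3', h2] at h4
    have : r ≤ j := by exact_mod_cast h4
    omega

end Paths

/-! ### Compound Poisson laws of mark sums -/

section MarkSums

variable {Ω : Type*} [MeasurableSpace Ω] {P : Measure Ω} {a lam : ℝ}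
  {time : ℕ → Ω → ℝ} {mark : ℕ → Ω → ℕ}

/-- The probability that a compound Poisson variable with Poisson parameter `lam * s` and geometric
jumps takes the value `j`. -/
noncomputable def compoundMass (a lam s : ℝ) (j : ℕ) : ℝ :=
  ∑ k ∈ Finset.range (j + 1),
    negBinomialMass a k j * (Real.exp (-(lam * s)) * (lam * s) ^ k / k.factorial)

lemma measurable_dirac_apply {f : Ω → ℝ} (hf : Measurable f) {B : Set ℝ} (hB : MeasurableSet B) :
    Measurable fun ω => Measure.dirac (f ω) B := by
  simp only [Measure.dirac_apply' _ hB]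
  exact (measurable_one.indicator hB).comp hf

lemma measurable_pointCount (htime : ∀ k, Measurable (time k)) {B : Set ℝ} (hB : MeasurableSet B) :
    Measurable (pointCount time B) :=
  Measurable.tsum fun k => measurable_dirac_apply (htime k) hB

lemma measurable_markSum (htime : ∀ k, Measurable (time k)) (hmark : ∀ k, Measurable (mark k))
    {B : Set ℝ} (hB : MeasurableSet B) : Measurable (markSum time mark B) :=
  Measurable.tsum fun k =>
    (measurable_from_top.comp (hmark k)).mul (measurable_dirac_apply (htime k) hB)

lemma IsPoissonPointProcess.lintegral_pointCount (htime : IsPoissonPointProcess P lam time)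
    {B : Set ℝ} (hB : MeasurableSet B) (hB0 : B ⊆ Set.Ici 0) (hBv : volume B ≠ ∞)
    {f : ℝ≥0∞ → ℝ≥0∞} (hf : Measurable f) :
    ∫⁻ ω, f (pointCount time B ω) ∂P =
      ∑' k : ℕ, f k * poissonMeasure (lam * (volume B).toReal).toNNReal {k} := by
  have h := htime.law_count B hB hB0 hBv
  rw [← lintegral_map hf (measurable_pointCount htime.measurable hB), h.map_eq,
    lintegral_map hf measurable_from_top, lintegral_countable']

lemma IsPoissonPointProcess.ae_pointCount_ne_top (htime : IsPoissonPointProcess P lam time)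
    {B : Set ℝ} (hB : MeasurableSet B) (hB0 : B ⊆ Set.Ici 0) (hBv : volume B ≠ ∞) :
    ∀ᵐ ω ∂P, pointCount time B ω ≠ ∞ := by
  have h := htime.law_count B hB hB0 hBv
  have hm : MeasurableSet {x : ℝ≥0∞ | x ≠ ∞} := (measurableSet_singleton _).compl
  refine (h.ae_iff (p := fun x => x ≠ ∞) (measurableSet_setOfPred.1 hm)).2 ?_
  rw [ae_map_iff measurable_from_top.aemeasurable hm]
  exact Filter.Eventually.of_forall fun n => ENNReal.natCast_ne_top n

lemma IsPoissonPointProcess.indepFun_pointCount (htime : IsPoissonPointProcess P lam time)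
    {B₁ B₂ : Set ℝ} (h₁ : MeasurableSet B₁) (h₂ : MeasurableSet B₂) (h₁' : B₁ ⊆ Set.Ici 0)
    (h₂' : B₂ ⊆ Set.Ici 0) (hd : Disjoint B₁ B₂) :
    IndepFun (pointCount time B₁) (pointCount time B₂) P := by
  have := htime.indep_count 2 ![B₁, B₂] (by simp [Fin.forall_fin_two, h₁, h₂])
    (by simp only [Fin.forall_fin_two]; exact ⟨h₁', h₂'⟩)
    (by
      intro i j hij
      fin_cases i <;> fin_cases j <;> simp_all [disjoint_comm])
  exact this.indepFun (i := 0) (j := 1) (by decide)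

/-- A Poisson mixture of negative binomial masses, finite because k ≤ j. The floor of `toReal` reads
the extended-real count as an integer. -/
lemma lintegral_negBinomialMass (ha0 : 0 ≤ a) (ha1 : a ≤ 1) (hlam : 0 ≤ lam)
    (htime : IsPoissonPointProcess P lam time)
    {B : Set ℝ} (hB : MeasurableSet B) (hB0 : B ⊆ Set.Ici 0) (hBv : volume B ≠ ∞) (j : ℕ) :
    ∫⁻ ω, ENNReal.ofReal (negBinomialMass a ⌊(pointCount time B ω).toReal⌋₊ j) ∂P =
      ENNReal.ofReal (compoundMass a lam (volume B).toReal j) := by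
  have hm : Measurable fun x : ℝ≥0∞ => ENNReal.ofReal (negBinomialMass a ⌊x.toReal⌋₊ j) := by
    have : Measurable fun k : ℕ => ENNReal.ofReal (negBinomialMass a k j) := measurable_from_top
    exact this.comp (Nat.measurable_floor.comp ENNReal.measurable_toReal)
  rw [htime.lintegral_pointCount hB hB0 hBv hm, tsum_eq_sum (s := Finset.range (j + 1)),
    compoundMass, ENNReal.ofReal_sum_of_nonneg]
  · refine Finset.sum_congr rfl fun k _ => ?_
    rw [ENNReal.toReal_natCast, Nat.floor_natCast, poissonMeasure_singleton,
      Real.coe_toNNReal _ (by positivity), ENNReal.ofReal_mul (negBinomialMass_nonneg ha0 ha1 _ _)]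
  · intro k _
    have := negBinomialMass_nonneg ha0 ha1 k j
    positivity
  · intro k hk
    rw [Finset.mem_range] at hk
    rw [ENNReal.toReal_natCast, Nat.floor_natCast, negBinomialMass_of_lt a (by omega)]
    simp

/-- The sums of the marks in two disjoint sets are independent with compound Poisson laws. -/
lemma measure_markSum_inter [IsProbabilityMeasure P] (ha0 : 0 < a) (ha1 : a < 1) (hlam : 0 < lam)
    (htime : IsPoissonPointProcess P lam time)
    (hmark : ∀ k, IsGeometric P a (mark k)) (hindep : iIndepFun mark P)
    (htm : IndepFun (fun ω k => time k ω) (fun ω k => mark k ω) P)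
    {B₁ B₂ : Set ℝ} (h₁ : MeasurableSet B₁) (h₂ : MeasurableSet B₂) (h₁' : B₁ ⊆ Set.Ici 0)
    (h₂' : B₂ ⊆ Set.Ici 0) (hv₁ : volume B₁ ≠ ∞) (hv₂ : volume B₂ ≠ ∞) (hd : Disjoint B₁ B₂)
    (j n : ℕ) :
    P {ω | markSum time mark B₁ ω = j ∧ markSum time mark B₂ ω = n} =
      ENNReal.ofReal (compoundMass a lam (volume B₁).toReal j) *
        ENNReal.ofReal (compoundMass a lam (volume B₂).toReal n) := by
  set f : ℕ → ℝ≥0∞ → ℝ≥0∞ := fun j x => ENNReal.ofReal (negBinomialMass a ⌊x.toReal⌋₊ j) with hf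
  have hfm : ∀ j, Measurable (f j) := by
    intro j
    have : Measurable fun k : ℕ => ENNReal.ofReal (negBinomialMass a k j) := measurable_from_top
    exact this.comp (Nat.measurable_floor.comp ENNReal.measurable_toReal)
  set E : Set Ω := {ω | markSum time mark B₁ ω = j ∧ markSum time mark B₂ ω = n} with hE
  have hEm : MeasurableSet E :=
    (measurable_markSum htime.measurable (fun k => (hmark k).1) h₁
      (measurableSet_singleton _)).inter
      (measurable_markSum htime.measurable (fun k => (hmark k).1) h₂ (measurableSet_singleton _))
  -- Partition by the index sets of the points lying in B₁ and B₂. This depends on the times only,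
  -- and on each cell the mark sums run over fixed finite sets, so independence of times and marks
  -- applies. The result depends only on the cardinalities, hence on the counts, which are
  -- independent.
  set U : Finset ℕ × Finset ℕ → Set (ℕ → ℝ) := fun F =>
    {x | ∀ k, (x k ∈ B₁ ↔ k ∈ F.1) ∧ (x k ∈ B₂ ↔ k ∈ F.2)} with hU
  have hUm : ∀ F, MeasurableSet (U F) := by
    intro F
    simp only [hU, Set.ofPred_forall]
    refine MeasurableSet.iInter fun k => ?_
    have e₁ : MeasurableSet {x : ℕ → ℝ | x k ∈ B₁} := measurable_pi_apply k h₁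
    have e₂ : MeasurableSet {x : ℕ → ℝ | x k ∈ B₂} := measurable_pi_apply k h₂
    exact (e₁.iff (MeasurableSet.const _)).inter (e₂.iff (MeasurableSet.const _))
  set T : Finset ℕ × Finset ℕ → Set Ω := fun F => (fun ω k => time k ω) ⁻¹' U F with hT
  have hTm : ∀ F, MeasurableSet (T F) := fun F => measurable_pi_iff.2 htime.measurable (hUm F)
  have hTd : Pairwise (Function.onFun Disjoint T) := by
    intro F F' hne
    rw [Function.onFun, Set.disjoint_left]
    intro ω h h'
    refine hne (Prod.ext ?_ ?_) <;> ext k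
    · exact (h k).1.symm.trans (h' k).1
    · exact (h k).2.symm.trans (h' k).2
  have hTu : ∀ᵐ ω ∂P, ω ∈ ⋃ F, T F := by
    filter_upwards [htime.ae_pointCount_ne_top h₁ h₁' hv₁, htime.ae_pointCount_ne_top h₂ h₂' hv₂]
      with ω e₁ e₂
    obtain ⟨F₁, hF₁⟩ := exists_finset_of_pointCount_ne_top h₁ e₁
    obtain ⟨F₂, hF₂⟩ := exists_finset_of_pointCount_ne_top h₂ e₂
    exact Set.mem_iUnion.2 ⟨(F₁, F₂), fun k => ⟨hF₁ k, hF₂ k⟩⟩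
  have hpiece : ∀ F, P (E ∩ T F) =
      ∫⁻ ω in T F, f j (pointCount time B₁ ω) * f n (pointCount time B₂ ω) ∂P := by
    intro F
    by_cases hF : Disjoint F.1 F.2
    · have e₁ : E ∩ T F = (fun ω k => time k ω) ⁻¹' U F ∩ (fun ω k => mark k ω) ⁻¹'
          {m : ℕ → ℕ | ∑ k ∈ F.1, m k = j ∧ ∑ k ∈ F.2, m k = n} := by
        ext ω
        rw [Set.inter_comm]
        refine and_congr_right fun hω => ?_
        have hω' : ∀ k, (time k ω ∈ B₁ ↔ k ∈ F.1) ∧ (time k ω ∈ B₂ ↔ k ∈ F.2) := hω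
        simp only [hE, Set.mem_ofPred_eq, Set.mem_preimage]
        rw [markSum_eq_sum h₁ fun k => (hω' k).1, markSum_eq_sum h₂ fun k => (hω' k).2,
          Nat.cast_inj, Nat.cast_inj]
      have hm : MeasurableSet {m : ℕ → ℕ | ∑ k ∈ F.1, m k = j ∧ ∑ k ∈ F.2, m k = n} := by
        have g : ∀ F : Finset ℕ, Measurable fun m : ℕ → ℕ => ∑ k ∈ F, m k := fun F => by fun_prop
        exact (g F.1 (measurableSet_singleton _)).inter (g F.2 (measurableSet_singleton _))
      rw [e₁, htm.measure_inter_preimage_eq_mul _ _ (hUm F) hm]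
      have e₂ := measure_sum_geometric_inter ha0 ha1 hmark hindep hF j n
      have e₃ : P ((fun ω k => mark k ω) ⁻¹'
          {m : ℕ → ℕ | ∑ k ∈ F.1, m k = j ∧ ∑ k ∈ F.2, m k = n}) = _ := e₂
      rw [e₃, setLIntegral_congr_fun (g := fun _ => ENNReal.ofReal (negBinomialMass a F.1.card j) *
        ENNReal.ofReal (negBinomialMass a F.2.card n)) (hTm F), setLIntegral_const, mul_comm]
      intro ω hω
      have hω' : ∀ k, (time k ω ∈ B₁ ↔ k ∈ F.1) ∧ (time k ω ∈ B₂ ↔ k ∈ F.2) := hω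
      simp only [hf]
      rw [pointCount_eq_card h₁ fun k => (hω' k).1, pointCount_eq_card h₂ fun k => (hω' k).2]
      simp
    -- A common index would place one point in both disjoint sets.
    · have : T F = ∅ := by
        rw [Set.eq_empty_iff_forall_notMem]
        intro ω hω
        have hω' : ∀ k, (time k ω ∈ B₁ ↔ k ∈ F.1) ∧ (time k ω ∈ B₂ ↔ k ∈ F.2) := hω
        refine hF (Finset.disjoint_left.2 fun k hk hk' => ?_)
        exact Set.disjoint_left.1 hd ((hω' k).1.2 hk) ((hω' k).2.2 hk')
      simp [this]
  have hPE : P E = ∫⁻ ω, f j (pointCount time B₁ ω) * f n (pointCount time B₂ ω) ∂P := by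
    calc P E = P (⋃ F, E ∩ T F) := by
          rw [← Set.inter_iUnion]
          refine measure_congr ?_
          filter_upwards [hTu] with ω hω
          exact propext ⟨fun h => ⟨h, hω⟩, fun h => h.1⟩
      _ = ∑' F, P (E ∩ T F) := measure_iUnion
          (fun F F' h => (hTd h).mono Set.inter_subset_right Set.inter_subset_right)
          (fun F => hEm.inter (hTm F))
      _ = ∑' F, ∫⁻ ω in T F, f j (pointCount time B₁ ω) * f n (pointCount time B₂ ω) ∂P := by
          simp only [hpiece]
      _ = ∫⁻ ω in ⋃ F, T F, f j (pointCount time B₁ ω) * f n (pointCount time B₂ ω) ∂P :=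
          (lintegral_iUnion hTm hTd _).symm
      _ = _ := by
          rw [Measure.restrict_eq_self_of_ae_mem hTu]
  rw [hPE, ← lintegral_negBinomialMass ha0.le ha1.le hlam.le htime h₁ h₁' hv₁ j,
    ← lintegral_negBinomialMass ha0.le ha1.le hlam.le htime h₂ h₂' hv₂ n]
  exact lintegral_mul_eq_lintegral_mul_lintegral_of_indepFun
    ((hfm j).comp (measurable_pointCount htime.measurable h₁))
    ((hfm n).comp (measurable_pointCount htime.measurable h₂))
    ((htime.indepFun_pointCount h₁ h₂ h₁' h₂' hd).comp (hfm j) (hfm n))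

/-- The joint law of `A(x)` and `A(x + z)`. -/
lemma measure_markedProcess_inter [IsProbabilityMeasure P] (ha0 : 0 < a) (ha1 : a < 1)
    (hlam : 0 < lam) (htime : IsPoissonPointProcess P lam time)
    (hmark : ∀ k, IsGeometric P a (mark k)) (hindep : iIndepFun mark P)
    (htm : IndepFun (fun ω k => time k ω) (fun ω k => mark k ω) P)
    {x z : ℝ} (hx : 0 ≤ x) (hz : 0 ≤ z) (j n : ℕ) :
    P {ω | markedProcess time mark x ω = j ∧ markedProcess time mark (x + z) ω = (j + n : ℕ)} =
      ENNReal.ofReal (compoundMass a lam x j) * ENNReal.ofReal (compoundMass a lam z n) := by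
  have h := measure_markSum_inter ha0 ha1 hlam htime hmark hindep htm
    (B₁ := Set.Icc 0 x) (B₂ := Set.Ioc x (x + z)) measurableSet_Icc measurableSet_Ioc
    (fun s hs => hs.1) (fun s hs => hx.trans hs.1.le) (by simp) (by simp)
    (by
      rw [Set.disjoint_left]
      intro s h h'
      exact not_lt.2 h.2 h'.1) j n
  rw [Real.volume_Icc, Real.volume_Ioc, add_sub_cancel_left, sub_zero, ENNReal.toReal_ofReal hx,
    ENNReal.toReal_ofReal hz] at h
  rw [← h]
  congr 1
  ext ω
  refine and_congr_right fun hω => ?_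
  have hω' : markSum time mark (Set.Icc 0 x) ω = j := hω
  rw [markedProcess_add hx hz, hω', Nat.cast_add]
  exact ENNReal.add_right_inj (ENNReal.natCast_ne_top j)

lemma measurable_markedProcess (htime : ∀ k, Measurable (time k))
    (hmark : ∀ k, Measurable (mark k)) :
    Measurable fun p : Ω × ℝ => markedProcess time mark p.2 p.1 := by
  refine Measurable.tsum fun k => ?_
  refine (measurable_from_top.comp ((hmark k).comp measurable_fst)).mul ?_
  simp only [Measure.dirac_apply' _ measurableSet_Icc]
  have hs : MeasurableSet {p : Ω × ℝ | 0 ≤ time k p.1 ∧ time k p.1 ≤ p.2} :=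
    (measurableSet_le measurable_const ((htime k).comp measurable_fst)).inter
      (measurableSet_le ((htime k).comp measurable_fst) measurable_snd)
  exact measurable_one.indicator hs

end MarkSums

/-! ### Integrals against exponential and gamma laws -/

section Integrals

variable {a lam mu : ℝ}

lemma gammaPDF_add_one {r x : ℝ} (hx : 0 ≤ x) (k : ℕ) :
    gammaPDF (k + 1) r x =
      ENNReal.ofReal (r ^ (k + 1) / k.factorial * x ^ k * Real.exp (-(r * x))) := by
  rw [gammaPDF_of_nonneg hx, Real.Gamma_nat_eq_factorial, add_sub_cancel_right,
    Real.rpow_natCast]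
  norm_cast

lemma measurable_gammaPDF (α r : ℝ) : Measurable (gammaPDF α r) :=
  (measurable_gammaPDFReal α r).ennreal_ofReal

lemma measurable_compoundMass (a lam : ℝ) (j : ℕ) : Measurable fun s => compoundMass a lam s j := by
  unfold compoundMass
  fun_prop

lemma poissonWeight_nonneg {s : ℝ} (hlam : 0 ≤ lam) (hs : 0 ≤ s) (k : ℕ) :
    0 ≤ Real.exp (-(lam * s)) * (lam * s) ^ k / k.factorial := by positivity

lemma ofReal_compoundMass (ha0 : 0 ≤ a) (ha1 : a ≤ 1) {s : ℝ} (hlam : 0 ≤ lam) (hs : 0 ≤ s)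
    (j : ℕ) :
    ENNReal.ofReal (compoundMass a lam s j) = ∑ k ∈ Finset.range (j + 1),
      ENNReal.ofReal (negBinomialMass a k j) *
        ENNReal.ofReal (Real.exp (-(lam * s)) * (lam * s) ^ k / k.factorial) := by
  rw [compoundMass, ENNReal.ofReal_sum_of_nonneg]
  · exact Finset.sum_congr rfl fun k _ => ENNReal.ofReal_mul (negBinomialMass_nonneg ha0 ha1 _ _)
  · exact fun k _ => mul_nonneg (negBinomialMass_nonneg ha0 ha1 _ _)
      (poissonWeight_nonneg hlam hs k)

lemma ae_nonneg_expMeasure (r : ℝ) : ∀ᵐ x ∂expMeasure r, 0 ≤ x := by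
  rw [expMeasure, gammaMeasure, ae_withDensity_iff (measurable_gammaPDF 1 r)]
  refine Filter.Eventually.of_forall fun x hx => ?_
  by_contra h
  exact hx (gammaPDF_of_neg (not_le.1 h))

/-- The Poisson weight times the exponential density is a constant multiple of the gamma density of
shape k + 1 and rate μ + λ. -/
lemma lintegral_poissonWeight_expMeasure (hlam : 0 < lam) (hmu : 0 < mu) (k : ℕ) :
    ∫⁻ z, ENNReal.ofReal (Real.exp (-(lam * z)) * (lam * z) ^ k / k.factorial) ∂expMeasure mu =
      ENNReal.ofReal (mu * lam ^ k / (mu + lam) ^ (k + 1)) := by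
  have h : ∀ z, gammaPDF 1 mu z *
      ENNReal.ofReal (Real.exp (-(lam * z)) * (lam * z) ^ k / k.factorial) =
      ENNReal.ofReal (mu * lam ^ k / (mu + lam) ^ (k + 1)) * gammaPDF (k + 1) (mu + lam) z := by
    intro z
    rcases lt_or_ge z 0 with hz | hz
    · rw [gammaPDF_of_neg hz, gammaPDF_of_neg hz, zero_mul, mul_zero]
    · have h1 := gammaPDF_add_one (r := mu) hz 0
      simp only [Nat.cast_zero, zero_add] at h1
      rw [h1, gammaPDF_add_one hz, ← ENNReal.ofReal_mul (by positivity),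
        ← ENNReal.ofReal_mul (by positivity)]
      congr 1
      rw [show -((mu + lam) * z) = -(mu * z) + -(lam * z) by ring, Real.exp_add, mul_pow]
      simp only [pow_one, Nat.factorial_zero, Nat.cast_one, div_one, pow_zero, mul_one]
      field_simp
  rw [expMeasure, gammaMeasure, lintegral_withDensity_eq_lintegral_mul _ (measurable_gammaPDF 1 mu)
    (by fun_prop)]
  simp only [Pi.mul_apply, h]
  rw [lintegral_const_mul _ (measurable_gammaPDF _ _),
    lintegral_gammaPDF_eq_one (by positivity) (by positivity), mul_one]

/-- The binomial theorem. With ρ = λ/(μ+λ), the number 1 - a + aρ is exactly c. -/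
lemma sum_negBinomialMass_mul_pow (a ρ : ℝ) (n : ℕ) :
    ∑ k ∈ Finset.range (n + 1), negBinomialMass a k n * ρ ^ k =
      coefR (1 - a) (1 - a + a * ρ) 0 n := by
  rcases n with _ | n
  · simp [negBinomialMass, coefR]
  · rw [Finset.sum_range_succ']
    simp only [negBinomialMass, zero_mul, add_zero, coefR, Nat.not_lt_zero, if_false,
      Nat.add_one_ne_zero, Nat.sub_zero, Nat.add_sub_cancel]
    rw [add_sub_cancel_left, add_comm (1 - a), add_pow, Finset.mul_sum]
    refine Finset.sum_congr rfl fun k _ => ?_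
    rw [mul_pow]
    ring

/-- The increment of the process over an independent exponential time. -/
lemma lintegral_compoundMass_expMeasure (ha0 : 0 ≤ a) (ha1 : a ≤ 1) (hlam : 0 < lam)
    (hmu : 0 < mu) (n : ℕ) :
    ∫⁻ z, ENNReal.ofReal (compoundMass a lam z n) ∂expMeasure mu =
      ENNReal.ofReal (mu / (mu + lam) * coefR (1 - a) (((1 - a) * mu + lam) / (mu + lam)) 0 n) := by
  have h : ∀ᵐ z ∂expMeasure mu, ENNReal.ofReal (compoundMass a lam z n) =
      ∑ k ∈ Finset.range (n + 1), ENNReal.ofReal (negBinomialMass a k n) *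
        ENNReal.ofReal (Real.exp (-(lam * z)) * (lam * z) ^ k / k.factorial) := by
    filter_upwards [ae_nonneg_expMeasure mu] with z hz
    exact ofReal_compoundMass ha0 ha1 hlam.le hz n
  rw [lintegral_congr_ae h, lintegral_finsetSum _ (by intro k _; fun_prop)]
  have hc : ((1 - a) * mu + lam) / (mu + lam) = 1 - a + a * (lam / (mu + lam)) := by
    field_simp
    ring
  rw [hc, ← sum_negBinomialMass_mul_pow, Finset.mul_sum, ENNReal.ofReal_sum_of_nonneg]
  · refine Finset.sum_congr rfl fun k _ => ?_
    rw [lintegral_const_mul _ (by fun_prop), lintegral_poissonWeight_expMeasure hlam hmu,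
      ← ENNReal.ofReal_mul (negBinomialMass_nonneg ha0 ha1 _ _)]
    congr 1
    rw [div_pow, pow_succ]
    field_simp
  · intro k _
    have := negBinomialMass_nonneg ha0 ha1 k n
    positivity

lemma lintegral_poissonWeight_Ioi (hlam : 0 < lam) {t : ℝ} (ht : 0 ≤ t) (k : ℕ) :
    ∫⁻ s in Set.Ioi t, ENNReal.ofReal (Real.exp (-(lam * s)) * (lam * s) ^ k / k.factorial) =
      ENNReal.ofReal (1 / lam * (1 - regGamma (k + 1) (lam * t))) := by
  have hint : IntegrableOn (fun x : ℝ => x ^ k * Real.exp (-x)) (Set.Ioi (lam * t)) := by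
    have h := Real.GammaIntegral_convergent (s := k + 1) (by positivity)
    simp only [add_sub_cancel_right, Real.rpow_natCast] at h
    exact (h.mono_set (Set.Ioi_subset_Ioi (by positivity))).congr_fun (fun x _ => mul_comm _ _)
      measurableSet_Ioi
  have e : ∀ s, Real.exp (-(lam * s)) * (lam * s) ^ k / k.factorial =
      (k.factorial : ℝ)⁻¹ * (fun x : ℝ => x ^ k * Real.exp (-x)) (lam * s) := by
    intro s
    simp only
    ring
  have hint' : IntegrableOn (fun s : ℝ => Real.exp (-(lam * s)) * (lam * s) ^ k / k.factorial)
      (Set.Ioi t) := by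
    simp only [e]
    refine Integrable.const_mul ?_ _
    exact (integrableOn_Ioi_comp_mul_left_iff _ t hlam).2 hint
  rw [← ofReal_integral_eq_lintegral_ofReal hint']
  · congr 1
    have hs := integral_comp_mul_left_Ioi (fun x : ℝ => x ^ k * Real.exp (-x)) t hlam
    simp only [e]
    rw [integral_const_mul, hs, regGamma,
      if_neg (Nat.succ_ne_zero k), sub_sub_cancel, Nat.add_sub_cancel, Nat.cast_succ,
      Real.Gamma_nat_eq_factorial, smul_eq_mul]
    ring
  · rw [Filter.EventuallyLE, ae_restrict_iff' measurableSet_Ioi]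
    exact Filter.Eventually.of_forall fun s hs =>
      poissonWeight_nonneg hlam.le (ht.trans (Set.mem_Ioi.1 hs).le) k

lemma regGamma_le_one (k : ℕ) {x : ℝ} (hx : 0 ≤ x) : regGamma k x ≤ 1 := by
  rw [regGamma]
  split_ifs with hk
  · exact le_rfl
  · have h1 : 0 ≤ ∫ s in Set.Ioi x, s ^ (k - 1) * Real.exp (-s) := by
      refine setIntegral_nonneg measurableSet_Ioi fun s hs => ?_
      have : 0 ≤ s := hx.trans (Set.mem_Ioi.1 hs).le
      positivity
    have h2 : 0 ≤ Real.Gamma k := Real.Gamma_nonneg_of_nonneg (by positivity)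
    have := div_nonneg h1 h2
    linarith

lemma lintegral_compoundMass_Ioi (ha0 : 0 ≤ a) (ha1 : a ≤ 1) (hlam : 0 < lam) {t : ℝ} (ht : 0 ≤ t)
    (j : ℕ) :
    ∫⁻ s in Set.Ioi t, ENNReal.ofReal (compoundMass a lam s j) =
      ENNReal.ofReal (1 / lam * ∑ k ∈ Finset.range (j + 1),
        negBinomialMass a k j * (1 - regGamma (k + 1) (lam * t))) := by
  rw [setLIntegral_congr_fun measurableSet_Ioi fun s hs =>
    ofReal_compoundMass ha0 ha1 hlam.le (ht.trans (Set.mem_Ioi.1 hs).le) j,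
    lintegral_finsetSum _ (by intro k _; fun_prop), Finset.mul_sum, ENNReal.ofReal_sum_of_nonneg]
  · refine Finset.sum_congr rfl fun k _ => ?_
    rw [lintegral_const_mul _ (by fun_prop), lintegral_poissonWeight_Ioi hlam ht,
      ← ENNReal.ofReal_mul (negBinomialMass_nonneg ha0 ha1 _ _)]
    congr 1
    ring
  · intro k _
    have h1 := negBinomialMass_nonneg ha0 ha1 k j
    have h2 := sub_nonneg.2 (regGamma_le_one (k + 1) (by positivity : 0 ≤ lam * t))
    positivity

/-- On 0 ≤ x ≤ w the exponentials combine to exp(-rw), leaving the integral of x^k; elsewhere one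
density is zero. -/
lemma lintegral_gammaPDF_mul_gammaPDF_one {r : ℝ} (hr : 0 < r) (k : ℕ) (w : ℝ) :
    ∫⁻ x, gammaPDF (k + 1) r x * gammaPDF 1 r (w - x) = gammaPDF (k + 2) r w := by
  rcases lt_or_ge w 0 with hw | hw
  · rw [gammaPDF_of_neg hw, ← lintegral_zero]
    refine lintegral_congr fun x => ?_
    rcases lt_or_ge x 0 with hx | hx
    · rw [gammaPDF_of_neg hx, zero_mul]
    · rw [gammaPDF_of_neg (by linarith : w - x < 0), mul_zero]
  · have h : ∀ x, gammaPDF (k + 1) r x * gammaPDF 1 r (w - x) = (Set.Icc 0 w).indicator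
        (fun x => ENNReal.ofReal (r ^ (k + 2) / k.factorial * Real.exp (-(r * w)) * x ^ k)) x := by
      intro x
      by_cases hx : x ∈ Set.Icc 0 w
      · rw [Set.indicator_of_mem hx, gammaPDF_add_one hx.1]
        have h1 := gammaPDF_add_one (r := r) (sub_nonneg.2 hx.2) 0
        simp only [Nat.cast_zero, zero_add] at h1
        have hx0 := hx.1
        rw [h1, ← ENNReal.ofReal_mul (by positivity)]
        congr 1
        rw [show -(r * w) = -(r * x) + -(r * (w - x)) by ring, Real.exp_add]
        simp only [pow_one, Nat.factorial_zero, Nat.cast_one, div_one, pow_zero, mul_one]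
        ring
      · rw [Set.indicator_of_notMem hx]
        rw [Set.mem_Icc, not_and_or, not_le, not_le] at hx
        rcases hx with hx | hx
        · rw [gammaPDF_of_neg hx, zero_mul]
        · rw [gammaPDF_of_neg (by linarith : w - x < 0), mul_zero]
    simp only [h]
    rw [lintegral_indicator measurableSet_Icc, ← ofReal_integral_eq_lintegral_ofReal]
    · rw [integral_const_mul, integral_Icc_eq_integral_Ioc, ← intervalIntegral.integral_of_le hw,
        integral_pow]
      have h2 := gammaPDF_add_one (r := r) hw (k + 1)
      rw [show ((k + 1 : ℕ) : ℝ) + 1 = k + 2 by push_cast; ring] at h2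
      rw [h2]
      congr 1
      rw [Nat.factorial_succ]
      push_cast
      field_simp
      simp
    · exact (Continuous.integrableOn_Icc (by fun_prop))
    · rw [Filter.EventuallyLE, ae_restrict_iff' measurableSet_Icc]
      refine Filter.Eventually.of_forall fun x hx => ?_
      have := hx.1
      positivity

lemma gammaMeasure_conv_expMeasure {r : ℝ} (hr : 0 < r) (k : ℕ) :
    (gammaMeasure (k + 1) r).conv (expMeasure r) = gammaMeasure (k + 2) r := by
  have := isProbabilityMeasure_expMeasure hr
  have := isProbabilityMeasure_gammaMeasure (a := k + 1) (by positivity) hr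
  refine Measure.ext_of_lintegral _ fun f hf => ?_
  rw [Measure.lintegral_conv hf]
  have h1 : ∀ x, ∫⁻ y, f (x + y) ∂expMeasure r = ∫⁻ w, gammaPDF 1 r (w - x) * f w := by
    intro x
    rw [expMeasure, gammaMeasure, lintegral_withDensity_eq_lintegral_mul _ (measurable_gammaPDF 1 r)
      (by fun_prop), ← lintegral_add_left_eq_self (fun w => gammaPDF 1 r (w - x) * f w) x]
    simp
  have hm : Measurable fun p : ℝ × ℝ => gammaPDF 1 r (p.2 - p.1) * f p.2 :=
    ((measurable_gammaPDF 1 r).comp (by fun_prop)).mul (by fun_prop)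
  simp only [h1]
  rw [gammaMeasure, lintegral_withDensity_eq_lintegral_mul _ (measurable_gammaPDF _ r)
      hm.lintegral_prod_right', gammaMeasure,
    lintegral_withDensity_eq_lintegral_mul _ (measurable_gammaPDF _ r) hf]
  simp only [Pi.mul_apply]
  have h2 : ∀ x, gammaPDF (k + 1) r x * ∫⁻ w, gammaPDF 1 r (w - x) * f w =
      ∫⁻ w, gammaPDF (k + 1) r x * (gammaPDF 1 r (w - x) * f w) := by
    intro x
    rw [lintegral_const_mul]
    exact hm.comp measurable_prodMk_left
  simp only [h2]
  rw [lintegral_lintegral_swap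
    (((measurable_gammaPDF _ r).comp measurable_fst).mul hm).aemeasurable]
  refine lintegral_congr fun w => ?_
  simp only [← mul_assoc]
  rw [lintegral_mul_const, lintegral_gammaPDF_mul_gammaPDF_one hr]
  exact (measurable_gammaPDF _ r).mul ((measurable_gammaPDF 1 r).comp (by fun_prop))

/-- The renewal density of the exponential distribution is constant. -/
lemma tsum_gammaPDF {r x : ℝ} (hr : 0 ≤ r) (hx : 0 ≤ x) :
    ∑' k : ℕ, gammaPDF (k + 1) r x = ENNReal.ofReal r := by
  have h : HasSum (fun k : ℕ => r ^ (k + 1) / k.factorial * x ^ k * Real.exp (-(r * x))) r := by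
    have h1 := (NormedSpace.expSeries_div_hasSum_exp (r * x)).mul_left (r * Real.exp (-(r * x)))
    rw [← Real.exp_eq_exp_ℝ, mul_assoc, ← Real.exp_add, neg_add_cancel, Real.exp_zero,
      mul_one] at h1
    convert! h1 using 2 with k
    rw [mul_pow]
    ring
  simp only [gammaPDF_add_one hx]
  rw [← ENNReal.ofReal_tsum_of_nonneg (fun k => by positivity) h.summable, h.tsum_eq]

/-- Tonelli and the constant renewal density: the mean number of observations in ds is r ds. -/
lemma tsum_setLIntegral_gammaMeasure {r t : ℝ} (hr : 0 ≤ r) (ht : 0 ≤ t) {f : ℝ → ℝ≥0∞}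
    (hf : Measurable f) :
    ∑' k : ℕ, ∫⁻ s in Set.Ioi t, f s ∂gammaMeasure (k + 1) r =
      ENNReal.ofReal r * ∫⁻ s in Set.Ioi t, f s := by
  have h : ∀ k : ℕ, ∫⁻ s in Set.Ioi t, f s ∂gammaMeasure (k + 1) r =
      ∫⁻ s in Set.Ioi t, gammaPDF (k + 1) r s * f s := by
    intro k
    rw [gammaMeasure, setLIntegral_withDensity_eq_setLIntegral_mul _ (measurable_gammaPDF _ r) hf
      measurableSet_Ioi]
    rfl
  simp only [h]
  rw [← lintegral_tsum (f := fun (k : ℕ) s => gammaPDF (k + 1) r s * f s)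
      fun k => ((measurable_gammaPDF _ r).mul hf).aemeasurable,
    ← lintegral_const_mul _ hf]
  refine setLIntegral_congr_fun measurableSet_Ioi fun s hs => ?_
  rw [ENNReal.tsum_mul_right, tsum_gammaPDF hr (ht.trans (Set.mem_Ioi.1 hs).le)]

end Integrals

/-! ### Random observation times and the law of the exit -/

section Passage

variable {Ω : Type*} [MeasurableSpace Ω] {P : Measure Ω} {a lam mu : ℝ}
  {time : ℕ → Ω → ℝ} {mark : ℕ → Ω → ℕ} {gap : ℕ → Ω → ℝ}

/-- The joint law of `τ`, `A(τ)` and `A(τ + δ)` for independent `τ` and `δ`, independent of the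
process. -/
lemma measure_markedProcess_random [IsProbabilityMeasure P] (ha0 : 0 < a) (ha1 : a < 1)
    (hlam : 0 < lam) (htime : IsPoissonPointProcess P lam time)
    (hmark : ∀ k, IsGeometric P a (mark k)) (hindep : iIndepFun mark P)
    (htm : IndepFun (fun ω k => time k ω) (fun ω k => mark k ω) P)
    {τ δ : Ω → ℝ} (hτ : Measurable τ) (hδ : Measurable δ) (hτ0 : ∀ ω, 0 ≤ τ ω) (hδ0 : ∀ ω, 0 ≤ δ ω)
    (hτδ : IndepFun τ δ P)
    (hproc : IndepFun (fun ω => ((fun k => time k ω), (fun k => mark k ω)))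
      (fun ω => (τ ω, δ ω)) P) (t : ℝ) (j n : ℕ) :
    P {ω | t < τ ω ∧ markedProcess time mark (τ ω) ω = j ∧
        markedProcess time mark (τ ω + δ ω) ω = (j + n : ℕ)} =
      (∫⁻ s in Set.Ioi t, ENNReal.ofReal (compoundMass a lam s j) ∂P.map τ) *
        ∫⁻ z, ENNReal.ofReal (compoundMass a lam z n) ∂P.map δ := by
  set π : Ω → (ℕ → ℝ) × (ℕ → ℕ) := fun ω => ((fun k => time k ω), (fun k => mark k ω)) with hπ
  have hπm : Measurable π :=
    (measurable_pi_iff.2 htime.measurable).prodMk (measurable_pi_iff.2 fun k => (hmark k).1)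
  -- Coordinate maps on the space of point and mark sequences: the event becomes a preimage of D
  -- under (π, (τ, δ)), whose law is a product. Fixing τ = s, δ = z by Fubini reduces to
  -- deterministic times.
  let ct : ℕ → (ℕ → ℝ) × (ℕ → ℕ) → ℝ := fun k p => p.1 k
  let cm : ℕ → (ℕ → ℝ) × (ℕ → ℕ) → ℕ := fun k p => p.2 k
  have hA : Measurable fun p : ((ℕ → ℝ) × (ℕ → ℕ)) × ℝ => markedProcess ct cm p.2 p.1 :=
    measurable_markedProcess (fun k => by fun_prop) (fun k => by fun_prop)
  set D : Set (((ℕ → ℝ) × (ℕ → ℕ)) × (ℝ × ℝ)) := {p | t < p.2.1 ∧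
    markedProcess ct cm p.2.1 p.1 = j ∧ markedProcess ct cm (p.2.1 + p.2.2) p.1 = (j + n : ℕ)}
    with hD
  have hDm : MeasurableSet D := by
    have h1 : Measurable fun p : ((ℕ → ℝ) × (ℕ → ℕ)) × (ℝ × ℝ) => markedProcess ct cm p.2.1 p.1 :=
      hA.comp (g := fun p : ((ℕ → ℝ) × (ℕ → ℕ)) × ℝ => markedProcess ct cm p.2 p.1)
        (f := fun p : ((ℕ → ℝ) × (ℕ → ℕ)) × (ℝ × ℝ) => (p.1, p.2.1)) (by fun_prop)
    have h2 : Measurable fun p : ((ℕ → ℝ) × (ℕ → ℕ)) × (ℝ × ℝ) =>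
        markedProcess ct cm (p.2.1 + p.2.2) p.1 :=
      hA.comp (g := fun p : ((ℕ → ℝ) × (ℕ → ℕ)) × ℝ => markedProcess ct cm p.2 p.1)
        (f := fun p : ((ℕ → ℝ) × (ℕ → ℕ)) × (ℝ × ℝ) => (p.1, p.2.1 + p.2.2)) (by fun_prop)
    have h3 : MeasurableSet {p : ((ℕ → ℝ) × (ℕ → ℕ)) × (ℝ × ℝ) | t < p.2.1} :=
      measurableSet_lt measurable_const (by fun_prop)
    exact h3.inter ((measurableSet_eq_fun h1 measurable_const).inter
      (measurableSet_eq_fun h2 measurable_const))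
  have hE : {ω | t < τ ω ∧ markedProcess time mark (τ ω) ω = j ∧
      markedProcess time mark (τ ω + δ ω) ω = (j + n : ℕ)} =
      (fun ω => (π ω, (τ ω, δ ω))) ⁻¹' D := rfl
  have := Measure.isProbabilityMeasure_map (μ := P) hπm.aemeasurable
  have := Measure.isProbabilityMeasure_map (μ := P) hτ.aemeasurable
  have := Measure.isProbabilityMeasure_map (μ := P) hδ.aemeasurable
  rw [hE, ← Measure.map_apply (hπm.prodMk (hτ.prodMk hδ)) hDm,
    hproc.map_prod_eq_prod_map_map hπm.aemeasurable (hτ.prodMk hδ).aemeasurable,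
    hτδ.map_prod_eq_prod_map_map hτ.aemeasurable hδ.aemeasurable, Measure.prod_apply_symm hDm,
    ← lintegral_indicator measurableSet_Ioi, ← lintegral_prod_mul
      (((measurable_compoundMass a lam j).ennreal_ofReal.indicator measurableSet_Ioi).aemeasurable)
      (measurable_compoundMass a lam n).ennreal_ofReal.aemeasurable]
  have hτ' : ∀ᵐ s ∂P.map τ, 0 ≤ s :=
    (ae_map_iff hτ.aemeasurable measurableSet_Ici).2 (Filter.Eventually.of_forall hτ0)
  have hδ' : ∀ᵐ s ∂P.map δ, 0 ≤ s :=
    (ae_map_iff hδ.aemeasurable measurableSet_Ici).2 (Filter.Eventually.of_forall hδ0)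
  refine lintegral_congr_ae ?_
  filter_upwards [Measure.quasiMeasurePreserving_fst.ae hτ',
    Measure.quasiMeasurePreserving_snd.ae hδ'] with p hp1 hp2
  rw [Measure.map_apply hπm (measurable_prodMk_right hDm)]
  by_cases hp : t < p.1
  · rw [Set.indicator_of_mem (Set.mem_Ioi.2 hp),
      ← measure_markedProcess_inter ha0 ha1 hlam htime hmark hindep htm hp1 hp2]
    congr 1
    ext ω
    exact ⟨fun h => h.2, fun h => ⟨hp, h⟩⟩
  · rw [Set.indicator_of_notMem (by simpa using hp), zero_mul]
    convert! measure_empty (μ := P)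
    rw [Set.eq_empty_iff_forall_notMem]
    exact fun ω h => hp h.1

lemma measurable_obsTime (hgap : ∀ k, Measurable (gap k)) (n : ℕ) : Measurable (obsTime gap n) :=
  Finset.measurable_sum _ fun k _ => hgap k

lemma measurable_obsValue (htime : ∀ k, Measurable (time k)) (hmark : ∀ k, Measurable (mark k))
    (hgap : ∀ k, Measurable (gap k)) (n : ℕ) : Measurable (obsValue time mark gap n) :=
  (measurable_markedProcess htime hmark).comp (measurable_id.prodMk (measurable_obsTime hgap n))

lemma measurableSet_passageFrom (htime : ∀ k, Measurable (time k))
    (hmark : ∀ k, Measurable (mark k)) (hgap : ∀ k, Measurable (gap k)) (t : ℝ) (r j m : ℕ) :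
    MeasurableSet (passageFrom time mark gap t r j m) :=
  (measurableSet_lt measurable_const (measurable_obsTime hgap _)).inter
    ((measurable_obsValue htime hmark hgap _ (measurableSet_singleton _)).inter
      (measurable_obsValue htime hmark hgap _ (measurableSet_singleton _)))

lemma indepFun_obsTime_gap (hgapm : ∀ k, Measurable (gap k)) (hindep : iIndepFun gap P) (n : ℕ) :
    IndepFun (obsTime gap n) (gap n) P := by
  have h := hindep.indepFun_finsetSum_of_notMem hgapm (s := Finset.range n) (i := n) (by simp)
  convert! h using 1
  ext ω
  simp [obsTime]

lemma hasLaw_obsTime [IsProbabilityMeasure P] (hmu : 0 < mu) (hgapm : ∀ k, Measurable (gap k))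
    (hgap : ∀ k, HasLaw (gap k) (expMeasure mu) P) (hindep : iIndepFun gap P) (n : ℕ) :
    HasLaw (obsTime gap (n + 1)) (gammaMeasure (n + 1) mu) P := by
  induction n with
  | zero =>
    have h : obsTime gap 1 = gap 0 := by ext ω; simp [obsTime]
    simpa [h, expMeasure] using hgap 0
  | succ n ih =>
    have := isProbabilityMeasure_expMeasure hmu
    have := isProbabilityMeasure_gammaMeasure (a := n + 1) (by positivity) hmu
    have h := (indepFun_obsTime_gap hgapm hindep (n + 1)).hasLaw_fun_add ih (hgap (n + 1))
    rw [gammaMeasure_conv_expMeasure hmu] at h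
    have e : obsTime gap (n + 2) = fun ω => obsTime gap (n + 1) ω + gap (n + 1) ω := by
      ext ω
      rw [obsTime, Finset.sum_range_succ]
      rfl
    rw [e, Nat.cast_succ, add_assoc, one_add_one_eq_two]
    exact h

/-- The law of the exit value and of the last observation time before the exit. -/
lemma measure_exitEvent [IsProbabilityMeasure P] (ha0 : 0 < a) (ha1 : a < 1)
    (hlam : 0 < lam) (hmu : 0 < mu) (htime : IsPoissonPointProcess P lam time)
    (hmark : ∀ k, IsGeometric P a (mark k)) (hmark_indep : iIndepFun mark P)
    (hgapm : ∀ k, Measurable (gap k)) (hgap0 : ∀ k ω, 0 ≤ gap k ω)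
    (hgap : ∀ k, HasLaw (gap k) (expMeasure mu) P) (hgap_indep : iIndepFun gap P)
    (htm : IndepFun (fun ω k => time k ω) (fun ω k => mark k ω) P)
    (hproc : IndepFun (fun ω => ((fun k => time k ω), (fun k => mark k ω)))
      (fun ω k => gap k ω) P) {M r : ℕ} (hr : M < r) {t : ℝ} (ht : 0 ≤ t) :
    P (exitEvent time mark gap M r t) = ∑ j ∈ Finset.range (M + 1),
      ENNReal.ofReal mu * ENNReal.ofReal (1 / lam * ∑ k ∈ Finset.range (j + 1),
        negBinomialMass a k j * (1 - regGamma (k + 1) (lam * t))) *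
      ENNReal.ofReal (mu / (mu + lam) *
        coefR (1 - a) (((1 - a) * mu + lam) / (mu + lam)) 0 (r - j)) := by
  have hms := measurableSet_passageFrom htime.measurable (fun k => (hmark k).1) hgapm t r
  rw [exitEvent_eq_iUnion hgap0 hr ht, measure_biUnion_finset]
  · refine Finset.sum_congr rfl fun j hj => ?_
    rw [Finset.mem_range_succ_iff] at hj
    rw [measure_iUnion (fun m m' h => passageFrom_disjoint hgap0 hr hj hj (Or.inr h)) (hms j)]
    have h : ∀ m, P (passageFrom time mark gap t r j m) =
        (∫⁻ s in Set.Ioi t, ENNReal.ofReal (compoundMass a lam s j) ∂gammaMeasure (m + 1) mu) *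
          ∫⁻ z, ENNReal.ofReal (compoundMass a lam z (r - j)) ∂expMeasure mu := by
      intro m
      -- The pair (τ_{m+1}, Δ_{m+2}) is a function of the gap sequence, so it inherits independence
      -- from the process.
      have hφ : Measurable fun g : ℕ → ℝ => (∑ k ∈ Finset.range (m + 1), g k, g (m + 1)) := by
        fun_prop
      have h1 := measure_markedProcess_random ha0 ha1 hlam htime hmark hmark_indep htm
        (measurable_obsTime hgapm (m + 1)) (hgapm (m + 1)) (obsTime_nonneg hgap0 (m + 1))
        (hgap0 (m + 1)) (indepFun_obsTime_gap hgapm hgap_indep (m + 1))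
        (hproc.comp measurable_id hφ) t j (r - j)
      rw [(hasLaw_obsTime hmu hgapm hgap hgap_indep m).map_eq, (hgap (m + 1)).map_eq,
        Nat.add_sub_cancel' (by omega)] at h1
      rw [← h1]
      congr 1
      ext ω
      simp only [passageFrom, obsValue, Set.mem_ofPred_eq]
      rw [show obsTime gap (m + 2) ω = obsTime gap (m + 1) ω + gap (m + 1) ω from
        Finset.sum_range_succ _ _]
    simp only [h]
    rw [ENNReal.tsum_mul_right, tsum_setLIntegral_gammaMeasure hmu.le ht
      (measurable_compoundMass a lam j).ennreal_ofReal,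
      lintegral_compoundMass_Ioi ha0.le ha1.le hlam ht,
      lintegral_compoundMass_expMeasure ha0.le ha1.le hlam hmu]
  · intro j hj j' hj' hne
    rw [Finset.coe_range, Set.mem_Iio, Nat.lt_succ_iff] at hj hj'
    rw [Function.onFun, Set.disjoint_iUnion_left]
    intro m
    rw [Set.disjoint_iUnion_right]
    exact fun m' => passageFrom_disjoint hgap0 hr hj hj' (Or.inl hne)
  · exact fun j _ => MeasurableSet.iUnion (hms j)

end Passage

end DelayedPassage

/-! ### Assembly of the two cases -/

open DelayedPassage
theorem mainTheorem9 {Ω : Type*} [MeasurableSpace Ω] (P : Measure Ω) [IsProbabilityMeasure P]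
    (a b c lam mu : ℝ) (ha0 : 0 < a) (ha1 : a < 1) (hlam : 0 < lam) (hmu : 0 < mu)
    (hb : b = 1 - a) (hc : c = (b * mu + lam) / (mu + lam))
    (time : ℕ → Ω → ℝ) (mark : ℕ → Ω → ℕ) (gap : ℕ → Ω → ℝ)
    -- the points form a Poisson process of intensity `lam`
    (htime : IsPoissonPointProcess P lam time)
    -- the marks are IID, geometric with parameter `a`
    (hmark : ∀ k, IsGeometric P a (mark k))
    (hmark_indep : iIndepFun mark P)
    -- the inter-observation times are IID, exponential with parameter `mu`
    (hgap : ∀ k, HasLaw (gap k) (expMeasure mu) P)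
    (hgap_indep : iIndepFun gap P)
    -- points, marks and observation times are independent
    (htime_mark : IndepFun (fun ω k => time k ω) (fun ω k => mark k ω) P)
    (hproc_gap : IndepFun (fun ω => ((fun k => time k ω), (fun k => mark k ω)))
      (fun ω k => gap k ω) P)
    (M r : ℕ) (t : ℝ) (ht : 0 ≤ t)
    (G H : ℕ → ℝ) (hG : G = coefG a lam mu t) (hH : H = coefH a lam mu t) :
    P.real (exitEvent time mark gap M r t) =
      mu / lam * (a * mu / (mu + lam)) *
        ((mu + lam) / (a * mu) * coefR b c 0 r + ∑ j ∈ Finset.Icc 1 M, coefR b c j r)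
      - mu / (mu + lam) *
        (G 0 * coefR b c 0 r + ∑ j ∈ Finset.Icc 1 M, (G j - H (j - 1)) * coefR b c j r)
      - mu / lam *
        (∑ j ∈ Finset.range (M + 1), ∑ i ∈ Finset.range (M + 1 - j), c ^ i * ind r (i + j)
          - (b + c) * ∑ j ∈ Finset.range M, ∑ i ∈ Finset.range (M - j), c ^ i * ind r (i + j + 1)
          + b * c * ∑ j ∈ Finset.range (M - 1), ∑ i ∈ Finset.range (M - 1 - j),
              c ^ i * ind r (i + j + 2))
      + mu / (mu + lam) *
        (∑ j ∈ Finset.range (M + 1), G j * ∑ i ∈ Finset.range (M + 1 - j), c ^ i * ind r (i + j)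
          - ∑ j ∈ Finset.range M, (b * G j + H j) * ∑ i ∈ Finset.range (M - j),
              c ^ i * ind r (i + j + 1)
          + b * ∑ j ∈ Finset.range (M - 1), H j * ∑ i ∈ Finset.range (M - 1 - j),
              c ^ i * ind r (i + j + 2)) := by
  rw [hG, hH]
  change _ = exitFormula a b c lam mu M r (coefG a lam mu t) (coefH a lam mu t)
  rcases le_or_gt r M with hr | hr
  · rw [exitEvent_eq_empty hr, exitFormula_of_le ha0 hlam hmu hb hc hr, measureReal_empty]
  -- `HasLaw` makes the gaps only almost everywhere measurable and nonnegative. They are replaced by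
  -- a measurable, everywhere nonnegative modification, which changes the event by a null set.
  have hgap_ae : ∀ k, gap k =ᵐ[P] fun ω => max ((hgap k).aemeasurable.mk _ ω) 0 := by
    intro k
    have h0 : ∀ᵐ ω ∂P, 0 ≤ gap k ω :=
      ((hgap k).ae_iff (p := fun x => 0 ≤ x) (measurableSet_setOfPred.1 measurableSet_Ici)).2
        (ae_nonneg_expMeasure mu)
    filter_upwards [(hgap k).aemeasurable.ae_eq_mk, h0] with ω h1 h2
    rw [← h1, max_eq_left h2]
  set gap' : ℕ → Ω → ℝ := fun k ω => max ((hgap k).aemeasurable.mk _ ω) 0 with hgap'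
  have hall : ∀ᵐ ω ∂P, ∀ k, gap k ω = gap' k ω := ae_all_iff.2 hgap_ae
  have hevent : exitEvent time mark gap M r t =ᵐ[P] exitEvent time mark gap' M r t := by
    filter_upwards [hall] with ω hω
    refine propext ?_
    change (∃ n, _) ↔ (∃ n, _)
    simp only [exitIndex, obsValue, obsTime, hω]
  have hproc' := hproc_gap.congr (g' := fun ω k => gap' k ω) Filter.EventuallyEq.rfl
    (hall.mono fun ω hω => funext hω)
  have hmain := measure_exitEvent ha0 ha1 hlam hmu htime hmark hmark_indep
    (gap := gap') (fun k => (hgap k).aemeasurable.measurable_mk.max measurable_const)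
    (fun k ω => le_max_right _ _) (fun k => (hgap k).congr (hgap_ae k).symm)
    (hgap_indep.congr hgap_ae) htime_mark hproc' hr ht
  have hcR : ∀ n, 0 ≤ coefR b c 0 n := by
    intro n
    have h1 : 0 ≤ c - b := by
      rw [hc, hb, show ((1 - a) * mu + lam) / (mu + lam) - (1 - a) = a * lam / (mu + lam) by
        field_simp; ring]
      positivity
    have h2 : 0 ≤ c := by linarith
    rw [coefR]
    split_ifs <;> positivity
  have htail : ∀ j, 0 ≤ ∑ k ∈ Finset.range (j + 1),
      negBinomialMass a k j * (1 - regGamma (k + 1) (lam * t)) := fun j =>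
    Finset.sum_nonneg fun k _ => mul_nonneg (negBinomialMass_nonneg ha0.le ha1.le k j)
      (sub_nonneg.2 (regGamma_le_one (k + 1) (by positivity)))
  rw [measureReal_congr hevent, measureReal_def, hmain, exitFormula_of_lt ha0 ha1 hlam hmu hr,
    ENNReal.toReal_sum fun j _ => by finiteness]
  refine Finset.sum_congr rfl fun j _ => ?_
  have h1 := htail j
  have h2 := hcR (r - j)
  rw [← hb, ← hc, ENNReal.toReal_mul, ENNReal.toReal_mul, ENNReal.toReal_ofReal hmu.le,
    ENNReal.toReal_ofReal (by positivity), ENNReal.toReal_ofReal (by positivity)]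
  ring
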